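/- Let $\mathrm{LC}(\mathbb{R})$ be the set of proper, lower semicontinuous, convex functions $u:\mathbb{R}\to(-\infty,+\infty]$ whose domain $\operatorname{dom}u=\{x: u(x)<+\infty\}$ is compact and which are Lipschitz on the interior of $\operatorname{dom}u$. A sequence $u_k\in \mathrm{LC}(\mathbb{R})$ is $\tau$-convergent to $u\in \mathrm{LC}(\mathbb{R})$ if for every $x\in\mathbb{R}$ (i) $u(x)\le\liminf_k u_k(x_k)$ for every sequence $x_k\to x$; (ii) $u(x)=\lim_k u_k(x_k)$ for some sequence $x_k\to x$; and if (iii) there is a constant $M$ such that every $u_k$ is $M$-Lipschitz on the interior of $\operatorname{dom}u_k$. For $K\subset\mathbb{R}$ let $I_K$ be $0$ on $K$ and $+\infty$ off $K$. Let $\mathrm{Conc}$ be the set of concave functions $\zeta:[0,\infty)\to[0,\infty)$ with $\lim_{t\to0}\zeta(t)=0$ and $\lim_{t\to\infty}\zeta(t)/t=0$. For $u\in \mathrm{LC}(\mathbb{R})$ and $x$ in the interior of $\operatorname{dom}u$, we call $u$ twice differentiable at $x$ with $u''(x)=h$ if $u(y)=u(x)+p(y-x)+\tfrac h2(y-x)^2+o((y-x)^2)$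 as $y\to x$ for some $p\in\mathbb{R}$ (twice differentiability in the sense of Aleksandrov); at all other points we set $u''(x)=0$. **Proposition.** Let $Z:\mathrm{LC}(\mathbb{R})\to\mathbb{R}$ satisfy the following conditions. - $Z$ is a valuation: $Z(u\wedge v)+Z(u\vee v)=Z(u)+Z(v)$ whenever $u,v$, the pointwise minimum $u\wedge v$ and the pointwise maximum $u\vee v$ all belong to $\mathrm{LC}(\mathbb{R})$. - $Z$ is simple: $Z(u)=0$ whenever $\operatorname{dom}u$ has empty interior. - $Z$ is $\tau$-upper semicontinuous: $Z(u)\ge\limsup_k Z(u_k)$ whenever $u_k$ is $\tau$-convergent to $u$. - $Z$ is translation invariant: $Z(u(\cdot+y))=Z(u)$ for all $u\in \mathrm{LC}(\mathbb{R})$ and $y\in\mathbb{R}$. - $Z$ is dually epi-translation invariant: $Z(u+l)=Z(u)$ and $Z(u+c)=Z(u)$ for all $u\in \mathrm{LC}(\mathbb{R})$, all linear functions $l:\mathbb{R}\to\mathbb{R}$ and all constants $c\in\mathbb{R}$. - $Z(I_{[\alpha,\beta]})=0$ for all real $\alpha\le\beta$. Then there is a function $\zeta\in\mathrm{Conc}$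 such that, for every $u\in \mathrm{LC}(\mathbb{R})$, the function $\zeta(u'')$ is integrable on $\operatorname{dom}u$ and $$Z(u)=\int_{\operatorname{dom}u}\zeta(u''(x))\,dx .$$ Moreover, for all $a\ge0$ and $m>0$, $$\zeta(a)=\frac1{2m}\,Z\Big(\frac{a x^2}{2}+I_{[-m,m]}\Big).$$ -/

import Mathlib

open Set Filter Topology MeasureTheory

noncomputable section

namespace LipConv

/-- The effective domain `{x | u x < +∞}` of an extended real valued function on `ℝ`. -/
def dom (u : ℝ → EReal) : Set ℝ := {x | u x < ⊤}

/-- The epigraph `{(x, t) ∈ ℝ² | u x ≤ t}`. -/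
def epi (u : ℝ → EReal) : Set (ℝ × ℝ) := {p | u p.1 ≤ (p.2 : EReal)}

/-- `u` belongs to `Conv(ℝ)`: it takes values in `(-∞, +∞]` and is proper, lower semicontinuous
(closed epigraph) and convex (convex epigraph). -/
structure IsConv (u : ℝ → EReal) : Prop where
  ne_bot : ∀ x, u x ≠ ⊥
  proper : (dom u).Nonempty
  lsc : IsClosed (epi u)
  convex : Convex ℝ (epi u)

/-- `u` is Lipschitz with constant `L` on the interior of its domain. -/
def LipschitzOnDom (L : NNReal) (u : ℝ → EReal) : Prop :=
  LipschitzOnWith L (fun x => (u x).toReal) (interior (dom u))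

/-- The space of proper, lower semicontinuous, convex functions on `ℝ` with compact domain that
are Lipschitz on the interior of their domain. -/
def LC : Set (ℝ → EReal) :=
  {u | IsConv u ∧ IsCompact (dom u) ∧ ∃ L : NNReal, LipschitzOnDom L u}

/-- The convex indicator function of a set: `0` on `K` and `+∞` off `K`. -/
def ind (K : Set ℝ) : ℝ → EReal :=
  open Classical in fun x => if x ∈ K then 0 else ⊤

/-- The function `x ↦ a x² / 2 + I_[α, β](x)`. -/
def quadInd (a α β : ℝ) : ℝ → EReal :=
  fun x => ((a * (x ^ 2 / 2) : ℝ) : EReal) + ind (Icc α β) x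

lemma ind_mem {K : Set ℝ} {x : ℝ} (h : x ∈ K) : ind K x = 0 := if_pos h

lemma ind_notMem {K : Set ℝ} {x : ℝ} (h : x ∉ K) : ind K x = ⊤ := if_neg h

lemma quadInd_mem {a α β x : ℝ} (h : x ∈ Icc α β) :
    quadInd a α β x = ((a * (x ^ 2 / 2) : ℝ) : EReal) := by
  simp [quadInd, ind_mem h]

lemma quadInd_notMem {a α β x : ℝ} (h : x ∉ Icc α β) : quadInd a α β x = ⊤ := by
  simp only [quadInd, ind_notMem h]
  exact EReal.coe_add_top _

lemma dom_quadInd (a α β : ℝ) : dom (quadInd a α β) = Icc α β := by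
  ext x
  by_cases h : x ∈ Icc α β
  · simp only [dom, mem_ofPred_eq, quadInd_mem h, h, EReal.coe_lt_top]
  · simp only [dom, mem_ofPred_eq, quadInd_notMem h, lt_irrefl, h]

lemma epi_quadInd (a α β : ℝ) :
    epi (quadInd a α β) = {p : ℝ × ℝ | p.1 ∈ Icc α β ∧ a * (p.1 ^ 2 / 2) ≤ p.2} := by
  ext p
  by_cases h : p.1 ∈ Icc α β
  · simp only [epi, mem_ofPred_eq, quadInd_mem h, EReal.coe_le_coe_iff, h, true_and]
  · simp only [epi, mem_ofPred_eq, quadInd_notMem h, h, false_and, iff_false]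
    exact not_le.mpr (EReal.coe_lt_top _)

lemma quadInd_mem_LC {a α β : ℝ} (ha : 0 ≤ a) (h : α ≤ β) : quadInd a α β ∈ LC := by
  refine ⟨⟨?_, ?_, ?_, ?_⟩, ?_, ?_⟩
  · intro x
    by_cases hx : x ∈ Icc α β
    · rw [quadInd_mem hx]; exact EReal.coe_ne_bot _
    · rw [quadInd_notMem hx]; exact top_ne_bot
  · rw [dom_quadInd]; exact nonempty_Icc.mpr h
  · rw [epi_quadInd]
    have h1 : IsClosed {p : ℝ × ℝ | p.1 ∈ Icc α β} := isClosed_Icc.preimage continuous_fst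
    have h2 : IsClosed {p : ℝ × ℝ | a * (p.1 ^ 2 / 2) ≤ p.2} :=
      isClosed_le (by fun_prop) (by fun_prop)
    exact h1.inter h2
  · rw [epi_quadInd]
    have hc : ConvexOn ℝ (Icc α β) (fun x : ℝ => a * (x ^ 2 / 2)) := by
      have h2 : ConvexOn ℝ (Icc α β) (fun x : ℝ => x ^ 2) :=
        (even_two.convexOn_pow).subset (subset_univ _) (convex_Icc α β)
      have h3 := h2.smul (c := a / 2) (by positivity)
      refine h3.congr ?_
      intro x _
      simp only [smul_eq_mul]
      ring
    exact hc.convex_epigraph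
  · rw [dom_quadInd]; exact isCompact_Icc
  · refine ⟨(a * (|α| + |β|)).toNNReal, ?_⟩
    rw [LipschitzOnDom, dom_quadInd]
    refine LipschitzOnWith.of_dist_le_mul ?_
    intro x hx y hy
    have hx' := interior_subset hx
    have hy' := interior_subset hy
    rw [quadInd_mem hx', quadInd_mem hy', EReal.toReal_coe, EReal.toReal_coe,
      Real.coe_toNNReal _ (by positivity), Real.dist_eq, Real.dist_eq]
    have e : a * (x ^ 2 / 2) - a * (y ^ 2 / 2) = a * ((x + y) / 2) * (x - y) := by ring
    rw [e, abs_mul, abs_mul, abs_of_nonneg ha]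
    gcongr
    obtain ⟨h1, h2⟩ := hx'
    obtain ⟨h3, h4⟩ := hy'
    have := neg_abs_le α
    have := le_abs_self β
    have := abs_nonneg α
    have := abs_nonneg β
    rw [abs_le]
    constructor <;> linarith

lemma ind_Icc_mem_LC {α β : ℝ} (h : α ≤ β) : ind (Icc α β) ∈ LC := by
  have e : ind (Icc α β) = quadInd 0 α β := by
    ext x
    simp [quadInd]
  rw [e]
  exact quadInd_mem_LC le_rfl h

/-- `τ`-convergence: epi-convergence together with a uniform bound on the Lipschitz constants on
the interiors of the domains. -/
structure TauTendsto (u : ℕ → LC) (v : LC) : Prop where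
  le_liminf : ∀ (x : ℝ) (y : ℕ → ℝ), Tendsto y atTop (𝓝 x) →
    v.1 x ≤ liminf (fun k => (u k).1 (y k)) atTop
  exists_recovery : ∀ x : ℝ, ∃ y : ℕ → ℝ, Tendsto y atTop (𝓝 x) ∧
    Tendsto (fun k => (u k).1 (y k)) atTop (𝓝 (v.1 x))
  lipschitz_bdd : ∃ M : NNReal, ∀ k, LipschitzOnDom M (u k).1

/-- `Z` is a valuation; the pointwise minimum and maximum have to lie in the space again. -/
def IsValuation (Z : LC → ℝ) : Prop :=
  ∀ (u v : LC) (hmin : u.1 ⊓ v.1 ∈ LC) (hmax : u.1 ⊔ v.1 ∈ LC),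
    Z ⟨u.1 ⊓ v.1, hmin⟩ + Z ⟨u.1 ⊔ v.1, hmax⟩ = Z u + Z v

/-- `Z` vanishes on all functions whose domain is not full dimensional. -/
def IsSimple (Z : LC → ℝ) : Prop :=
  ∀ u : LC, interior (dom u.1) = ∅ → Z u = 0

/-- `τ`-upper semicontinuity; the upper limit is taken in the extended reals. -/
def TauUSC (Z : LC → ℝ) : Prop :=
  ∀ (u : ℕ → LC) (v : LC), TauTendsto u v →
    limsup (fun k => (Z (u k) : EReal)) atTop ≤ (Z v : EReal)

/-- `Z (u ∘ τ) = Z u` for all translations `τ x = x + y` (where `u ∘ τ` is in the space, too). -/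
def TranslationInvariant (Z : LC → ℝ) : Prop :=
  ∀ (u v : LC) (y : ℝ), (∀ x, v.1 x = u.1 (x + y)) → Z v = Z u

/-- `Z (u + l) = Z u` for every linear function `l x = b x`. -/
def DuallyTranslationInvariant (Z : LC → ℝ) : Prop :=
  ∀ (u v : LC) (b : ℝ), (∀ x, v.1 x = u.1 x + ((b * x : ℝ) : EReal)) → Z v = Z u

/-- `Z (u + c) = Z u` for every constant `c`. -/
def VerticallyTranslationInvariant (Z : LC → ℝ) : Prop :=
  ∀ (u v : LC) (c : ℝ), (∀ x, v.1 x = u.1 x + (c : EReal)) → Z v = Z u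

/-- Dual epi-translation invariance. -/
def DuallyEpiTranslationInvariant (Z : LC → ℝ) : Prop :=
  DuallyTranslationInvariant Z ∧ VerticallyTranslationInvariant Z

/-- `Z` vanishes on the indicator functions of closed intervals `[α, β]`. -/
def VanishesOnIntervals (Z : LC → ℝ) : Prop :=
  ∀ (α β : ℝ) (h : α ≤ β), Z ⟨ind (Icc α β), ind_Icc_mem_LC h⟩ = 0

/-- The class of concave `ζ : [0, ∞) → [0, ∞)` with `ζ t → 0` as `t → 0` and `ζ t / t → 0` as
`t → ∞`; only the values of `ζ` on `[0, ∞)` are used. -/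
structure IsConc (ζ : ℝ → ℝ) : Prop where
  nonneg : ∀ t, 0 ≤ t → 0 ≤ ζ t
  concave : ConcaveOn ℝ (Ici 0) ζ
  tendsto_zero : Tendsto ζ (𝓝[>] 0) (𝓝 0)
  tendsto_div : Tendsto (fun t => ζ t / t) atTop (𝓝 0)

/-- `u` is twice differentiable at the interior point `x` of its domain in the sense of Aleksandrov,
with second derivative `h`: for some `p`,
`u y = u x + p (y - x) + h (y - x)² / 2 + o((y - x)²)` as `y → x`.
(The first derivative of a convex function may fail to exist on a countable dense set, so that
differentiating twice in the naive sense would not give an almost everywhere defined notion.) -/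
def HasSecondDerivAt (u : ℝ → EReal) (h x : ℝ) : Prop :=
  x ∈ interior (dom u) ∧ ∃ p : ℝ,
    (fun y => (u y).toReal - (u x).toReal - p * (y - x) - h / 2 * (y - x) ^ 2)
      =o[𝓝 x] fun y => (y - x) ^ 2

/-- The second derivative `u''(x)`, set to `0` where `u` is not twice differentiable. -/
def secondDeriv (u : ℝ → EReal) (x : ℝ) : ℝ :=
  open Classical in if H : ∃ h, HasSecondDerivAt u h x then H.choose else 0

end LipConv

end

open LipConv

/-!
A function in the space whose domain is a nondegenerate interval `[a, b]` is, up to a constant, the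
primitive of a monotone function `g` on `[a, b]`. Write `energy Z g a b` for the value of `Z` there.
The valuation property and simplicity make `energy` additive in the interval
(`IsAdmissible.energy_add`), and the invariances let arcs be moved and glued: translating an arc, or
adding a constant to its slope, does not change its energy. In particular the energy of the slope
function `x ↦ t * x` is proportional to the length of the interval, with a factor `zeta Z t`, and
affine functions have energy zero. Upper semicontinuity gives inequalities only; the theorem follows
by finding an approximation in either direction.

* If short arcs over intervals of length `1 / n` have mean second derivative tending to `h`, then
  their periodic repetition converges to a quadratic function, so their energy per unit length is
  asymptotically at most `zeta Z h` (`IsAdmissible.energy_arc_lt`). Arcs with a single kink show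
  that `zeta Z` is nonnegative, arcs consisting of two parabolas that it is concave.

* Lower bound (`IsAdmissible.integral_zeta_deriv_le`). Interpolating `g` linearly at equidistant
  points gives piecewise quadratic functions that converge to the given one. Their energies are
  integrals of `zeta Z` of difference quotients of `g`, which converge almost everywhere to
  `zeta Z (deriv g x)`, and Fatou's lemma applies.

* Upper bound (`IsAdmissible.energy_eq_integral`). The function `F x = energy Z g a x` is
  nondecreasing. Applied to the arcs of the given function over `[x, x + 1 / n]`, the bound for
  short arcs says that its derivative is at most `zeta Z (deriv g x)`. It remains to see that `F` is
  absolutely continuous. The arcs over finitely many disjoint intervals can be concatenated to one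
  convex function, with the same bound for its slopes, whose domain is as long as the intervals
  together (`IsAdmissible.exists_concat`). As this length tends to zero these functions `τ`-converge
  to one whose domain is a point, where `Z` vanishes, so the sum of the energies tends to zero.

Finally, the primitive of `g` is twice differentiable in the sense of Aleksandrov wherever `g` is
differentiable, hence almost everywhere, with second derivative `deriv g x`.
-/

noncomputable section

namespace LipConv

/-! ### Finite convex functions on an interval, as elements of the space -/

/-- The function equal to `f` on `[a, b]` and to `+∞` elsewhere. -/
def restr (f : ℝ → ℝ) (a b : ℝ) : ℝ → EReal := fun x => (f x : EReal) + ind (Icc a b) x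

/-- The convex function on `[a, b]` with slope function `g` that vanishes at `a`. -/
def prim (g : ℝ → ℝ) (a b : ℝ) : ℝ → EReal := restr (fun x => ∫ t in a..x, g t) a b

lemma restr_of_mem {f : ℝ → ℝ} {a b x : ℝ} (hx : x ∈ Icc a b) : restr f a b x = f x := by
  simp [restr, ind_mem hx]

lemma restr_of_notMem {f : ℝ → ℝ} {a b x : ℝ} (hx : x ∉ Icc a b) : restr f a b x = ⊤ := by
  simp only [restr, ind_notMem hx]
  exact EReal.coe_add_top _

lemma dom_restr (f : ℝ → ℝ) (a b : ℝ) : dom (restr f a b) = Icc a b := by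
  ext x
  by_cases h : x ∈ Icc a b
  · simp only [dom, mem_ofPred_eq, restr_of_mem h, h, EReal.coe_lt_top]
  · simp only [dom, mem_ofPred_eq, restr_of_notMem h, lt_irrefl, h]

lemma epi_restr (f : ℝ → ℝ) (a b : ℝ) :
    epi (restr f a b) = {p : ℝ × ℝ | p.1 ∈ Icc a b ∧ f p.1 ≤ p.2} := by
  ext p
  by_cases h : p.1 ∈ Icc a b
  · simp only [epi, mem_ofPred_eq, restr_of_mem h, EReal.coe_le_coe_iff, h, true_and]
  · simp only [epi, mem_ofPred_eq, restr_of_notMem h, h, false_and, iff_false]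
    exact not_le.mpr (EReal.coe_lt_top _)

lemma restr_congr {f₁ f₂ : ℝ → ℝ} {a b : ℝ} (h : EqOn f₁ f₂ (Icc a b)) :
    restr f₁ a b = restr f₂ a b := by
  ext x
  by_cases hx : x ∈ Icc a b
  · rw [restr_of_mem hx, restr_of_mem hx, h hx]
  · rw [restr_of_notMem hx, restr_of_notMem hx]

lemma lipschitzOnDom_restr {f : ℝ → ℝ} {a b : ℝ} {M : NNReal}
    (hf : LipschitzOnWith M f (Icc a b)) : LipschitzOnDom M (restr f a b) := by
  rw [LipschitzOnDom, dom_restr]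
  intro x hx y hy
  simp only [restr_of_mem (interior_subset hx), restr_of_mem (interior_subset hy),
    EReal.toReal_coe]
  exact hf (interior_subset hx) (interior_subset hy)

lemma restr_mem_LC {f : ℝ → ℝ} {a b : ℝ} {M : NNReal} (hab : a ≤ b)
    (hc : ConvexOn ℝ (Icc a b) f) (hf : LipschitzOnWith M f (Icc a b)) : restr f a b ∈ LC := by
  refine ⟨⟨fun x => ?_, ?_, ?_, ?_⟩, ?_, M, lipschitzOnDom_restr hf⟩
  · by_cases hx : x ∈ Icc a b
    · rw [restr_of_mem hx]; exact EReal.coe_ne_bot _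
    · rw [restr_of_notMem hx]; exact top_ne_bot
  · rw [dom_restr]; exact nonempty_Icc.mpr hab
  · rw [epi_restr]; exact isClosed_Icc.epigraph hf.continuousOn
  · rw [epi_restr]; exact hc.convex_epigraph
  · rw [dom_restr]; exact isCompact_Icc

section Slope

variable {g : ℝ → ℝ} {a b : ℝ}

lemma intervalIntegrable_of_monotoneOn (hg : MonotoneOn g (Icc a b)) {x y : ℝ}
    (hx : x ∈ Icc a b) (hy : y ∈ Icc a b) : IntervalIntegrable g volume x y :=
  (hg.mono (uIcc_subset_Icc hx hy)).intervalIntegrable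

lemma abs_le_of_monotoneOn (hg : MonotoneOn g (Icc a b)) {x : ℝ} (hx : x ∈ Icc a b) :
    |g x| ≤ max |g a| |g b| := by
  have h1 := hg (left_mem_Icc.2 (hx.1.trans hx.2)) hx hx.1
  have h2 := hg hx (right_mem_Icc.2 (hx.1.trans hx.2)) hx.2
  exact abs_le_max_abs_abs h1 h2

lemma convexOn_integral (hg : MonotoneOn g (Icc a b)) :
    ConvexOn ℝ (Icc a b) (fun x => ∫ t in a..x, g t) := by
  refine convexOn_of_slope_mono_adjacent (convex_Icc a b) ?_
  intro x y z hx hz hxy hyz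
  have ha : a ∈ Icc a b := left_mem_Icc.2 (hx.1.trans hx.2)
  have hy : y ∈ Icc a b := ⟨hx.1.trans hxy.le, hyz.le.trans hz.2⟩
  have i := fun {u v : ℝ} => intervalIntegrable_of_monotoneOn hg (x := u) (y := v)
  rw [intervalIntegral.integral_interval_sub_left (i ha hy) (i ha hx),
    intervalIntegral.integral_interval_sub_left (i ha hz) (i ha hy)]
  have h1 : ∫ t in x..y, g t ≤ (y - x) * g y := by
    have := intervalIntegral.integral_mono_on hxy.le (i hx hy) (intervalIntegrable_const (c := g y))
      (fun t ht => hg ⟨hx.1.trans ht.1, ht.2.trans hy.2⟩ hy ht.2)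
    simpa using this
  have h2 : (z - y) * g y ≤ ∫ t in y..z, g t := by
    have := intervalIntegral.integral_mono_on hyz.le (intervalIntegrable_const (c := g y)) (i hy hz)
      (fun t ht => hg hy ⟨hy.1.trans ht.1, ht.2.trans hz.2⟩ ht.1)
    simpa using this
  refine le_trans (b := g y) ((div_le_iff₀ (sub_pos.2 hxy)).2 ?_)
    ((le_div_iff₀ (sub_pos.2 hyz)).2 ?_) <;> linarith

lemma lipschitzOnWith_integral (hg : MonotoneOn g (Icc a b)) {M : NNReal}
    (hM : ∀ x ∈ Icc a b, |g x| ≤ M) :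
    LipschitzOnWith M (fun x => ∫ t in a..x, g t) (Icc a b) := by
  refine LipschitzOnWith.of_dist_le_mul fun x hx y hy => ?_
  have ha : a ∈ Icc a b := left_mem_Icc.2 (hx.1.trans hx.2)
  have i := fun {u v : ℝ} => intervalIntegrable_of_monotoneOn hg (x := u) (y := v)
  rw [Real.dist_eq, intervalIntegral.integral_interval_sub_left (i ha hx) (i ha hy), Real.dist_eq]
  refine intervalIntegral.norm_integral_le_of_norm_le_const (f := g) fun t ht => hM t ?_
  exact uIcc_subset_Icc hy hx (uIoc_subset_uIcc ht)

lemma prim_mem_LC (hab : a ≤ b) (hg : MonotoneOn g (Icc a b)) : prim g a b ∈ LC :=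
  restr_mem_LC (M := ⟨max |g a| |g b|, by positivity⟩) hab (convexOn_integral hg)
    (lipschitzOnWith_integral hg fun _ hx => abs_le_of_monotoneOn hg hx)

end Slope

/-! ### Convergence -/

/-- A criterion for `τ`-convergence that allows the right end points of the domains to move. -/
lemma tauTendsto_restr {φ : ℕ → ℝ → ℝ} {f : ℝ → ℝ} {β : ℕ → ℝ} {a b : ℝ} {M : NNReal}
    (hL : ∀ k, LipschitzOnWith M (φ k) (Icc a (β k))) (hβ : ∀ k, a ≤ β k)
    (hlim : Tendsto β atTop (𝓝 b))
    (hf : ∀ x ∈ Icc a b, Tendsto (fun k => φ k (min x (β k))) atTop (𝓝 (f x)))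
    {u : ℕ → LC} {v : LC} (hu : ∀ k, (u k).1 = restr (φ k) a (β k)) (hv : v.1 = restr f a b) :
    TauTendsto u v := by
  have hout : ∀ (x : ℝ) (y : ℕ → ℝ), Tendsto y atTop (𝓝 x) → x ∉ Icc a b →
      ∀ᶠ k in atTop, (u k).1 (y k) = ⊤ := by
    intro x y hy hx
    rw [mem_Icc, not_and_or, not_le, not_le] at hx
    rcases hx with hx | hx
    · filter_upwards [hy.eventually_lt_const hx] with k hk
      rw [hu, restr_of_notMem fun h => absurd h.1 (not_le.2 hk)]
    · filter_upwards [hlim.eventually_lt hy hx] with k hk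
      rw [hu, restr_of_notMem fun h => absurd h.2 (not_le.2 hk)]
  have hmin : ∀ x ∈ Icc a b, Tendsto (fun k => min x (β k)) atTop (𝓝 x) := by
    intro x hx
    have := (tendsto_const_nhds (x := x)).min hlim
    rwa [min_eq_left hx.2] at this
  refine ⟨fun x y hy => ?_, fun x => ?_, M, fun k => by rw [hu]; exact lipschitzOnDom_restr (hL k)⟩
  · by_cases hx : x ∈ Icc a b
    · set c : ℕ → ℝ := fun k => φ k (min x (β k)) - M * |y k - min x (β k)| with hc
      have hct : Tendsto c atTop (𝓝 (f x)) := by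
        have := (hf x hx).sub (((hy.sub (hmin x hx)).abs).const_mul (M : ℝ))
        simpa using this
      have hcE : Tendsto (fun k => (c k : EReal)) atTop (𝓝 (f x : EReal)) :=
        (continuous_coe_real_ereal.tendsto _).comp hct
      rw [hv, restr_of_mem hx, ← hcE.liminf_eq]
      refine liminf_le_liminf (Eventually.of_forall fun k => ?_)
      rw [hu]
      by_cases hyk : y k ∈ Icc a (β k)
      · rw [restr_of_mem hyk, EReal.coe_le_coe_iff]
        have h1 := (hL k).dist_le_mul _ (⟨le_min hx.1 (hβ k), min_le_right _ _⟩ :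
          min x (β k) ∈ Icc a (β k)) _ hyk
        rw [Real.dist_eq, Real.dist_eq, abs_sub_comm (min x (β k))] at h1
        have h2 := le_abs_self (φ k (min x (β k)) - φ k (y k))
        simp only [hc]
        linarith
      · rw [restr_of_notMem hyk]; exact le_top
    · rw [hv, restr_of_notMem hx, liminf_congr (hout x y hy hx)]
      simp
  · by_cases hx : x ∈ Icc a b
    · refine ⟨fun k => min x (β k), hmin x hx, ?_⟩
      rw [hv, restr_of_mem hx]
      refine Tendsto.congr (fun k => ?_) ((continuous_coe_real_ereal.tendsto _).comp (hf x hx))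
      rw [hu, restr_of_mem ⟨le_min hx.1 (hβ k), min_le_right _ _⟩]
      rfl
    · refine ⟨fun _ => x, tendsto_const_nhds, ?_⟩
      rw [hv, restr_of_notMem hx]
      exact tendsto_const_nhds.congr' ((hout x _ tendsto_const_nhds hx).mono fun k hk => hk.symm)

/-! ### The energy of a slope function -/

/-- The functionals under consideration, all hypotheses bundled. -/
structure IsAdmissible (Z : LC → ℝ) : Prop where
  valuation : IsValuation Z
  simple : IsSimple Z
  usc : TauUSC Z
  trans : TranslationInvariant Z
  dual : DuallyEpiTranslationInvariant Z
  vanish : VanishesOnIntervals Z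

/-- The extension of `Z` by zero to all functions, which spares membership proofs. -/
def extZ (Z : LC → ℝ) (w : ℝ → EReal) : ℝ :=
  open Classical in if h : w ∈ LC then Z ⟨w, h⟩ else 0

/-- The value of `Z` at the convex function on `[a, b]` with slope function `g`. -/
def energy (Z : LC → ℝ) (g : ℝ → ℝ) (a b : ℝ) : ℝ := extZ Z (prim g a b)

variable {Z : LC → ℝ} {f g : ℝ → ℝ} {a b c : ℝ}

lemma extZ_of_mem {w : ℝ → EReal} (h : w ∈ LC) : extZ Z w = Z ⟨w, h⟩ := dif_pos h

lemma extZ_coe (u : LC) : extZ Z u.1 = Z u := extZ_of_mem u.2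

/-- Adding an affine function does not change `Z`. -/
lemma IsAdmissible.extZ_restr_add_affine (hZ : IsAdmissible Z) {M : NNReal} (hab : a ≤ b)
    (hc : ConvexOn ℝ (Icc a b) f) (hL : LipschitzOnWith M f (Icc a b)) (k l : ℝ) :
    extZ Z (restr (fun x => f x + (k * x + l)) a b) = extZ Z (restr f a b) := by
  have key : ∀ k l : ℝ, restr (fun x => f x + (k * x + l)) a b ∈ LC := by
    intro k l
    have h1 : LipschitzOnWith ‖k‖₊ (fun x : ℝ => k * x + l) (Icc a b) := by
      refine LipschitzOnWith.of_dist_le_mul fun x _ y _ => ?_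
      rw [Real.dist_eq, Real.dist_eq, coe_nnnorm, Real.norm_eq_abs, ← abs_mul]
      refine le_of_eq (congrArg _ ?_)
      ring
    have h2 : ConvexOn ℝ (Icc a b) (fun x : ℝ => k * x + l) := by
      refine ⟨convex_Icc a b, fun x _ y _ s t _ _ hst => le_of_eq ?_⟩
      simp only [smul_eq_mul]
      obtain rfl : s = 1 - t := by linarith
      ring
    exact restr_mem_LC hab (hc.add h2) (hL.add h1)
  have h0 := restr_mem_LC hab hc hL
  rw [extZ_of_mem (key k l), extZ_of_mem h0]
  rw [hZ.dual.2 ⟨_, key k 0⟩ ⟨_, key k l⟩ l, hZ.dual.1 ⟨_, h0⟩ ⟨_, key k 0⟩ k]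
  · intro x
    by_cases hx : x ∈ Icc a b
    · simp [restr_of_mem hx]
    · simp only [restr_of_notMem hx]; exact (EReal.top_add_coe _).symm
  · intro x
    by_cases hx : x ∈ Icc a b
    · simp [restr_of_mem hx, ← EReal.coe_add, add_assoc]
    · simp only [restr_of_notMem hx]; exact (EReal.top_add_coe _).symm

lemma energy_congr (h : EqOn f g (Ioo a b)) : energy Z f a b = energy Z g a b := by
  unfold energy prim
  rw [restr_congr]
  intro x hx
  exact intervalIntegral.integral_congr_Ioo_of_le hx.1 (h.mono (Ioo_subset_Ioo_right hx.2))

/-- The restrictions of a convex function to `[a, b]` and to `[b, c]` have the given function as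
their minimum, and their maximum lives on `{b}`, where `Z` vanishes by simplicity. -/
lemma IsAdmissible.energy_add (hZ : IsAdmissible Z) (hab : a ≤ b) (hbc : b ≤ c)
    (hg : MonotoneOn g (Icc a c)) : energy Z g a b + energy Z g b c = energy Z g a c := by
  set F : ℝ → ℝ := fun x => ∫ t in a..x, g t with hF
  have hac := hab.trans hbc
  have hg1 : MonotoneOn g (Icc a b) := hg.mono (Icc_subset_Icc_right hbc)
  have hg2 : MonotoneOn g (Icc b c) := hg.mono (Icc_subset_Icc_left hab)
  have hM := fun x (hx : x ∈ Icc a c) => abs_le_of_monotoneOn hg hx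
  have hL := lipschitzOnWith_integral (M := ⟨max |g a| |g c|, by positivity⟩) hg hM
  have hL2 := hL.mono (Icc_subset_Icc_left hab : Icc b c ⊆ Icc a c)
  have hc2 := (convexOn_integral hg).subset (Icc_subset_Icc_left hab) (convex_Icc b c)
  have e : energy Z g b c = extZ Z (restr F b c) := by
    rw [← hZ.extZ_restr_add_affine hbc hc2 hL2 0 (-F b)]
    unfold energy prim
    rw [restr_congr]
    intro x hx
    have i := fun {u v : ℝ} => intervalIntegrable_of_monotoneOn hg (x := u) (y := v)
    have ha : a ∈ Icc a c := ⟨le_rfl, hac⟩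
    have hxc : x ∈ Icc a c := ⟨hab.trans hx.1, hx.2⟩
    have := intervalIntegral.integral_interval_sub_left (i ha hxc) (i ha ⟨hab, hbc⟩)
    simp only [hF, ← this]
    ring
  have m1 : restr F a b ∈ LC := prim_mem_LC hab hg1
  have m2 : restr F b c ∈ LC := restr_mem_LC hbc hc2 hL2
  have m3 : restr F a c ∈ LC := prim_mem_LC hac hg
  have m4 : restr F b b ∈ LC := restr_mem_LC le_rfl
    (hc2.subset (Icc_subset_Icc_right hbc) (convex_Icc b b))
    (hL2.mono (Icc_subset_Icc_right hbc : Icc b b ⊆ Icc b c))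
  have hinf : restr F a b ⊓ restr F b c = restr F a c := by
    ext x
    rw [Pi.inf_apply]
    rcases lt_trichotomy x b with hx | rfl | hx
    · rw [restr_of_notMem (a := b) fun h => absurd h.1 (not_le.2 hx), inf_top_eq]
      by_cases h : a ≤ x
      · rw [restr_of_mem ⟨h, hx.le⟩, restr_of_mem ⟨h, hx.le.trans hbc⟩]
      · rw [restr_of_notMem fun h' => h h'.1, restr_of_notMem fun h' => h h'.1]
    · rw [restr_of_mem ⟨hab, le_rfl⟩, restr_of_mem ⟨le_rfl, hbc⟩, restr_of_mem ⟨hab, hbc⟩, inf_idem]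
    · rw [restr_of_notMem (b := b) fun h => absurd h.2 (not_le.2 hx), top_inf_eq]
      by_cases h : x ≤ c
      · rw [restr_of_mem ⟨hx.le, h⟩, restr_of_mem ⟨hab.trans hx.le, h⟩]
      · rw [restr_of_notMem fun h' => h h'.2, restr_of_notMem fun h' => h h'.2]
  have hsup : restr F a b ⊔ restr F b c = restr F b b := by
    ext x
    rw [Pi.sup_apply]
    rcases lt_trichotomy x b with hx | rfl | hx
    · have h : x ∉ Icc b c := fun h => absurd h.1 (not_le.2 hx)
      have h' : x ∉ Icc b b := fun h => absurd h.1 (not_le.2 hx)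
      rw [restr_of_notMem h, restr_of_notMem h', sup_top_eq]
    · rw [restr_of_mem ⟨hab, le_rfl⟩, restr_of_mem ⟨le_rfl, hbc⟩, restr_of_mem ⟨le_rfl, le_rfl⟩,
        sup_idem]
    · have h : x ∉ Icc a b := fun h => absurd h.2 (not_le.2 hx)
      have h' : x ∉ Icc b b := fun h => absurd h.2 (not_le.2 hx)
      rw [restr_of_notMem h, restr_of_notMem h', top_sup_eq]
  have hv := hZ.valuation ⟨_, m1⟩ ⟨_, m2⟩ (by rw [hinf]; exact m3) (by rw [hsup]; exact m4)
  rw [e]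
  have e1 : energy Z g a b = extZ Z (restr F a b) := rfl
  have e3 : energy Z g a c = extZ Z (restr F a c) := rfl
  rw [e1, e3, extZ_of_mem m1, extZ_of_mem m2, ← hv, extZ_of_mem m3]
  have z4 : Z ⟨restr F a b ⊔ restr F b c, by rw [hsup]; exact m4⟩ = 0 := by
    apply hZ.simple
    simp only [hsup, dom_restr]
    simp
  rw [z4, add_zero]
  congr 2

lemma IsAdmissible.energy_self (hZ : IsAdmissible Z) (g : ℝ → ℝ) (a : ℝ) :
    energy Z g a a = 0 := by
  have hm : prim g a a ∈ LC := prim_mem_LC le_rfl (by simp)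
  rw [energy, extZ_of_mem hm]
  apply hZ.simple
  simp [prim, dom_restr]

lemma IsAdmissible.energy_comp_add (hZ : IsAdmissible Z) (s : ℝ) (hab : a ≤ b)
    (hg : MonotoneOn g (Icc (a + s) (b + s))) :
    energy Z (fun x => g (x + s)) a b = energy Z g (a + s) (b + s) := by
  have m1 : prim g (a + s) (b + s) ∈ LC := prim_mem_LC (by linarith) hg
  have m2 : prim (fun x => g (x + s)) a b ∈ LC := prim_mem_LC hab fun x hx y hy hxy =>
    hg ⟨by linarith [hx.1], by linarith [hx.2]⟩ ⟨by linarith [hy.1], by linarith [hy.2]⟩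
      (by linarith)
  rw [energy, energy, extZ_of_mem m1, extZ_of_mem m2]
  refine hZ.trans _ _ s fun x => ?_
  by_cases hx : x ∈ Icc a b
  · have hx' : x + s ∈ Icc (a + s) (b + s) := ⟨by linarith [hx.1], by linarith [hx.2]⟩
    simp only [prim, restr_of_mem hx, restr_of_mem hx']
    rw [intervalIntegral.integral_comp_add_right]
  · have hx' : x + s ∉ Icc (a + s) (b + s) := fun h => hx ⟨by linarith [h.1], by linarith [h.2]⟩
    simp only [prim, restr_of_notMem hx, restr_of_notMem hx']

lemma IsAdmissible.energy_add_const (hZ : IsAdmissible Z) (k : ℝ) (hab : a ≤ b)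
    (hg : MonotoneOn g (Icc a b)) :
    energy Z (fun x => g x + k) a b = energy Z g a b := by
  have hM := fun x (hx : x ∈ Icc a b) => abs_le_of_monotoneOn hg hx
  have hL := lipschitzOnWith_integral (M := ⟨max |g a| |g b|, by positivity⟩) hg hM
  rw [energy, energy, prim, prim,
    ← hZ.extZ_restr_add_affine hab (convexOn_integral hg) hL k (-(k * a)), restr_congr]
  intro x hx
  have i := intervalIntegrable_of_monotoneOn hg (left_mem_Icc.2 hab) hx
  simp only
  rw [intervalIntegral.integral_add i intervalIntegrable_const, intervalIntegral.integral_const]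
  simp only [smul_eq_mul]
  ring

lemma IsAdmissible.energy_const (hZ : IsAdmissible Z) (k : ℝ) (hab : a ≤ b) :
    energy Z (fun _ => k) a b = 0 := by
  have h := hZ.energy_add_const (g := fun _ => 0) k hab monotoneOn_const
  simp only [zero_add] at h
  have e : prim (fun _ => 0) a b = ind (Icc a b) := by
    ext x
    simp [prim, restr]
  rw [h, energy, e, extZ_of_mem (ind_Icc_mem_LC hab)]
  exact hZ.vanish a b hab

/-- Upper semicontinuity of `Z` in terms of slope functions; the right end point may move. -/
lemma IsAdmissible.energy_usc (hZ : IsAdmissible Z) {φ : ℕ → ℝ → ℝ} {β : ℕ → ℝ} {M : ℝ}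
    (hβ : ∀ k, a ≤ β k) (hlim : Tendsto β atTop (𝓝 b))
    (hφ : ∀ k, MonotoneOn (φ k) (Icc a (β k))) (hg : MonotoneOn g (Icc a b))
    (hM : ∀ k, ∀ x ∈ Icc a (β k), |φ k x| ≤ M)
    (hf : ∀ x ∈ Icc a b, Tendsto (fun k => ∫ t in a..min x (β k), φ k t) atTop
      (𝓝 (∫ t in a..x, g t)))
    {ε : ℝ} (hε : 0 < ε) : ∀ᶠ k in atTop, energy Z (φ k) a (β k) < energy Z g a b + ε := by
  have hab : a ≤ b := ge_of_tendsto' hlim hβ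
  have hM0 : 0 ≤ M := (abs_nonneg _).trans (hM 0 a ⟨le_rfl, hβ 0⟩)
  have hu := fun k => prim_mem_LC (hβ k) (hφ k)
  have hv := prim_mem_LC hab hg
  have := hZ.usc (fun k => ⟨_, hu k⟩) ⟨_, hv⟩ (tauTendsto_restr (M := ⟨M, hM0⟩)
    (fun k => lipschitzOnWith_integral (hφ k) (hM k)) hβ hlim hf (fun k => rfl) rfl)
  have h2 : limsup (fun k => (Z ⟨_, hu k⟩ : EReal)) atTop
      < ((energy Z g a b + ε : ℝ) : EReal) := by
    refine this.trans_lt ?_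
    rw [EReal.coe_lt_coe_iff, energy, extZ_of_mem hv]
    linarith
  filter_upwards [eventually_lt_of_limsup_lt h2] with k hk
  rw [EReal.coe_lt_coe_iff] at hk
  rwa [energy, extZ_of_mem (hu k)]

/-- Upper semicontinuity on a fixed interval. -/
lemma IsAdmissible.energy_usc_of_ae (hZ : IsAdmissible Z) {φ : ℕ → ℝ → ℝ} {M : ℝ} (hab : a ≤ b)
    (hφ : ∀ k, MonotoneOn (φ k) (Icc a b)) (hg : MonotoneOn g (Icc a b))
    (hM : ∀ k, ∀ x ∈ Icc a b, |φ k x| ≤ M)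
    (hf : ∀ᵐ x, x ∈ Icc a b → Tendsto (fun k => φ k x) atTop (𝓝 (g x)))
    {ε : ℝ} (hε : 0 < ε) : ∀ᶠ k in atTop, energy Z (φ k) a b < energy Z g a b + ε := by
  refine hZ.energy_usc (fun _ => hab) tendsto_const_nhds hφ hg hM (fun x hx => ?_) hε
  simp only [min_eq_left hx.2]
  have hsub : uIoc a x ⊆ Icc a b := by
    rw [uIoc_of_le hx.1]
    exact fun t ht => ⟨ht.1.le, ht.2.trans hx.2⟩
  refine intervalIntegral.tendsto_integral_filter_of_dominated_convergence (fun _ => M)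
    (Eventually.of_forall fun k => ?_) (Eventually.of_forall fun k => ?_)
    intervalIntegrable_const ?_
  · exact (intervalIntegrable_of_monotoneOn (hφ k) (left_mem_Icc.2 hab)
      hx).aestronglyMeasurable_restrict_uIoc
  · exact Eventually.of_forall fun t ht => hM k t (hsub ht)
  · exact hf.mono fun t ht h => ht (hsub h)

/-- The energy is uniformly small on short intervals: the graphs shrink to a point. -/
lemma IsAdmissible.exists_forall_energy_lt (hZ : IsAdmissible Z) (M : ℝ) {ε : ℝ} (hε : 0 < ε) :
    ∃ δ > 0, ∀ (g : ℝ → ℝ) (d : ℝ), 0 ≤ d → d < δ → MonotoneOn g (Icc 0 d) →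
      (∀ x ∈ Icc 0 d, |g x| ≤ M) → energy Z g 0 d < ε := by
  by_contra! H
  choose φ β h0 hlt hφ hM hge using fun k : ℕ => H (1 / ((k : ℝ) + 1)) (by positivity)
  have hlim : Tendsto β atTop (𝓝 0) :=
    squeeze_zero h0 (fun k => (hlt k).le) tendsto_one_div_add_atTop_nhds_zero_nat
  have h := hZ.energy_usc (g := fun _ => 0) h0 hlim hφ monotoneOn_const hM ?_ hε
  · obtain ⟨k, hk⟩ := h.exists
    rw [hZ.energy_self, zero_add] at hk
    exact absurd hk (not_lt.2 (hge k))
  · intro x hx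
    obtain rfl : x = 0 := le_antisymm hx.2 hx.1
    simp [h0]

/-! ### The density on quadratic functions -/

/-- An additive function on `[0, ∞)` that is small from above near `0` is linear. -/
lemma eq_mul_of_additive_of_small (hadd : ∀ x y, 0 ≤ x → 0 ≤ y → f (x + y) = f x + f y)
    (hsmall : ∀ ε > 0, ∃ δ > 0, ∀ h, 0 ≤ h → h < δ → f h < ε) {m : ℝ} (hm : 0 ≤ m) :
    f m = m * f 1 := by
  have hmul : ∀ (n : ℕ) (x : ℝ), 0 ≤ x → f (n * x) = n * f x := by
    intro n x hx
    induction n with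
    | zero =>
      have := hadd 0 0 le_rfl le_rfl
      simp at this ⊢
      exact this
    | succ n ih =>
      push_cast
      rw [add_mul, one_mul, hadd _ _ (by positivity) hx, ih]
      ring
  refine eq_of_forall_dist_le fun ε hε => ?_
  obtain ⟨δ, hδ, H⟩ := hsmall (ε / 3) (by positivity)
  obtain ⟨n, hn⟩ := exists_nat_gt (max (1 / δ) (3 * |f 1| / ε))
  have hn1 := (le_max_left _ _).trans_lt hn
  have hn2 := (le_max_right _ _).trans_lt hn
  have hn0 : (0 : ℝ) < n := lt_of_le_of_lt (by positivity) hn1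
  have e1 : f 1 = n * f (1 / n) := by
    rw [← hmul _ _ (by positivity), mul_one_div_cancel hn0.ne']
  have hd : (1 : ℝ) / n < δ := (one_div_lt hδ hn0).1 hn1
  have hf1 : |f 1| / n < ε / 3 := by
    rw [div_lt_iff₀ hε] at hn2
    rw [div_lt_iff₀ hn0]
    linarith
  set k := ⌊n * m⌋₊ with hk
  have hk1 : (k : ℝ) ≤ n * m := Nat.floor_le (by positivity)
  have hk2 : n * m < k + 1 := Nat.lt_floor_add_one _
  set s := m - k * (1 / n) with hs
  have hs0 : 0 ≤ s := by
    rw [hs, sub_nonneg, mul_one_div, div_le_iff₀ hn0]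
    linarith
  have hs1 : s < 1 / n := by
    rw [hs, sub_lt_iff_lt_add, ← one_add_mul, mul_one_div, lt_div_iff₀ hn0]
    linarith
  have e2 : f m = k * f (1 / n) + f s := by
    rw [← hmul _ _ (by positivity), ← hadd _ _ (by positivity) hs0, hs]
    congr 1
    ring
  have e3 : f (1 / n) = f s + f (1 / n - s) := by
    rw [← hadd _ _ hs0 (by linarith)]
    congr 1
    ring
  have h1 := H s hs0 (by linarith)
  have h2 := H (1 / n - s) (by linarith) (by linarith)
  have e4 : f m - m * f 1 = f s - s * f 1 := by
    have : (k : ℝ) * (1 / n) * (n * f (1 / n)) = k * f (1 / n) := by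
      field_simp
    rw [e2, hs, sub_mul, e1, this]
    ring
  have h3 : |s * f 1| ≤ |f 1| / n := by
    rw [abs_mul, abs_of_nonneg hs0, div_eq_mul_one_div, mul_comm]
    gcongr
  have h4 : |f (1 / n)| = |f 1| / n := by
    rw [e1, abs_mul, abs_of_pos hn0]
    field_simp
  rw [Real.dist_eq, e4, abs_le]
  have h5 := abs_le.1 h3
  have h6 := abs_le.1 h4.le
  constructor <;> linarith

/-- The energy per unit length of the quadratic functions with second derivative `t`. Negative `t`
are replaced by `0`, so that the function is continuous, hence measurable, on all of `ℝ`. -/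
def zeta (Z : LC → ℝ) (t : ℝ) : ℝ := energy Z (fun x => max t 0 * x) 0 1

lemma monotone_mul {t : ℝ} (ht : 0 ≤ t) : Monotone fun x : ℝ => t * x :=
  fun _ _ h => mul_le_mul_of_nonneg_left h ht

lemma IsAdmissible.energy_mul (hZ : IsAdmissible Z) {t : ℝ} (ht : 0 ≤ t) (hab : a ≤ b) :
    energy Z (fun x => t * x) a b = (b - a) * zeta Z t := by
  have hmono := monotone_mul ht
  have shift : ∀ {a b : ℝ}, a ≤ b →
      energy Z (fun x => t * x) a b = energy Z (fun x => t * x) 0 (b - a) := by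
    intro a b hab
    have h1 := hZ.energy_comp_add (g := fun x => t * x) (a := 0) (b := b - a) a (by linarith)
      (hmono.monotoneOn _)
    have h2 := hZ.energy_add_const (g := fun x => t * x) (a := 0) (b := b - a) (t * a)
      (by linarith) (hmono.monotoneOn _)
    simp only [mul_add, zero_add, sub_add_cancel] at h1
    rw [← h1, h2]
  rw [shift hab, zeta, max_eq_left ht]
  refine eq_mul_of_additive_of_small (f := fun m => energy Z (fun x => t * x) 0 m) ?_ ?_
    (sub_nonneg.2 hab)
  · intro x y hx hy
    rw [← hZ.energy_add hx (le_add_of_nonneg_right hy) (hmono.monotoneOn _),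
      shift (le_add_of_nonneg_right hy), add_sub_cancel_left]
  · intro ε hε
    obtain ⟨δ, hδ, H⟩ := hZ.exists_forall_energy_lt t hε
    refine ⟨min δ 1, by positivity, fun h h0 h1 => H _ h h0 (h1.trans_le (min_le_left _ _))
      (hmono.monotoneOn _) fun x hx => ?_⟩
    have hx1 : x ≤ 1 := hx.2.trans (h1.le.trans (min_le_right _ _))
    rw [abs_of_nonneg (mul_nonneg ht hx.1)]
    exact mul_le_of_le_one_right ht hx1

/-! ### Slope functions that are glued along a grid -/

/-- The function that takes the value `V i` at the grid point `i r` and follows `q i`, shifted by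
`i r`, on the cell from there to the next grid point. -/
def glue (r : ℝ) (V : ℤ → ℝ) (q : ℤ → ℝ → ℝ) (x : ℝ) : ℝ :=
  V ⌊x / r⌋ + q ⌊x / r⌋ (x - ⌊x / r⌋ * r)

section Glue

variable {r : ℝ} {V : ℤ → ℝ} {q : ℤ → ℝ → ℝ}

lemma sub_floor_mul_mem (hr : 0 < r) (x : ℝ) : x - ⌊x / r⌋ * r ∈ Icc 0 r := by
  have h1 := (le_div_iff₀ hr).1 (Int.floor_le (x / r))
  have h2 := (div_lt_iff₀ hr).1 (Int.lt_floor_add_one (x / r))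
  rw [add_mul] at h2
  constructor <;> linarith

lemma le_glue (hr : 0 < r) (hq : ∀ i, MonotoneOn (q i) (Icc 0 r)) (hq0 : ∀ i, q i 0 = 0) (x : ℝ) :
    V ⌊x / r⌋ ≤ glue r V q x := by
  have hx := sub_floor_mul_mem hr x
  have := hq ⌊x / r⌋ (left_mem_Icc.2 hr.le) hx hx.1
  rw [hq0] at this
  exact le_add_of_nonneg_right this

lemma glue_le (hr : 0 < r) (hq : ∀ i, MonotoneOn (q i) (Icc 0 r))
    (hqr : ∀ i, q i r = V (i + 1) - V i) (x : ℝ) :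
    glue r V q x ≤ V (⌊x / r⌋ + 1) := by
  have hx := sub_floor_mul_mem hr x
  have := hq ⌊x / r⌋ hx (right_mem_Icc.2 hr.le) hx.2
  rw [hqr] at this
  rw [glue]
  linarith

lemma monotone_of_glue (hr : 0 < r) (hq : ∀ i, MonotoneOn (q i) (Icc 0 r)) (hq0 : ∀ i, q i 0 = 0)
    (hqr : ∀ i, q i r = V (i + 1) - V i) : Monotone V := by
  refine monotone_int_of_le_succ fun i => ?_
  have := hq i (left_mem_Icc.2 hr.le) (right_mem_Icc.2 hr.le) hr.le
  rw [hq0, hqr] at this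
  linarith

lemma monotone_glue (hr : 0 < r) (hq : ∀ i, MonotoneOn (q i) (Icc 0 r)) (hq0 : ∀ i, q i 0 = 0)
    (hqr : ∀ i, q i r = V (i + 1) - V i) : Monotone (glue r V q) := by
  intro x y hxy
  have hfl : ⌊x / r⌋ ≤ ⌊y / r⌋ := Int.floor_le_floor (div_le_div_of_nonneg_right hxy hr.le)
  rcases hfl.eq_or_lt with h | h
  · have hx := sub_floor_mul_mem hr x
    have hy := sub_floor_mul_mem hr y
    rw [glue, glue]
    rw [h] at hx ⊢
    have := hq ⌊y / r⌋ hx hy (by linarith)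
    linarith
  · exact (glue_le hr hq hqr x).trans
      ((monotone_of_glue hr hq hq0 hqr (Int.add_one_le_iff.2 h)).trans (le_glue hr hq hq0 y))

lemma IsAdmissible.energy_glue (hZ : IsAdmissible Z) (hr : 0 < r)
    (hq : ∀ i, MonotoneOn (q i) (Icc 0 r)) (hq0 : ∀ i, q i 0 = 0)
    (hqr : ∀ i, q i r = V (i + 1) - V i) (n : ℕ) :
    energy Z (glue r V q) 0 (n * r) = ∑ i ∈ Finset.range n, energy Z (q i) 0 r := by
  have hmono := monotone_glue hr hq hq0 hqr
  induction n with
  | zero => simp [hZ.energy_self]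
  | succ n ih =>
    have e1 : energy Z (glue r V q) (n * r) ((n + 1 : ℕ) * r) = energy Z (q n) 0 r := by
      have h1 := hZ.energy_comp_add (g := glue r V q) (a := 0) (b := r) (n * r) hr.le
        (hmono.monotoneOn _)
      rw [zero_add, show r + n * r = (n + 1 : ℕ) * r by push_cast; ring] at h1
      rw [← h1, ← hZ.energy_add_const (V n) hr.le (hq n)]
      refine energy_congr fun x hx => ?_
      have hfl : ⌊(x + n * r) / r⌋ = (n : ℤ) := by
        rw [Int.floor_eq_iff, le_div_iff₀ hr, div_lt_iff₀ hr]
        push_cast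
        constructor <;> nlinarith [hx.1, hx.2]
      simp only [glue, hfl]
      push_cast
      rw [add_sub_cancel_right, add_comm]
    rw [Finset.sum_range_succ, ← ih, ← e1]
    refine (hZ.energy_add (by positivity) ?_ (hmono.monotoneOn _)).symm
    push_cast
    nlinarith

end Glue

/-- Periodic repetition of short arcs with mean second derivative `h` converges to a quadratic
function, hence the energy per unit length of such arcs is asymptotically at most `ζ(h)`. -/
lemma IsAdmissible.energy_arc_lt (hZ : IsAdmissible Z) {p : ℕ → ℝ → ℝ} {h : ℝ}
    (hp : ∀ k : ℕ, MonotoneOn (p k) (Icc 0 (1 / ((k : ℝ) + 1)))) (hp0 : ∀ k, p k 0 = 0)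
    (hlim : Tendsto (fun k : ℕ => ((k : ℝ) + 1) * p k (1 / ((k : ℝ) + 1))) atTop (𝓝 h))
    {ε : ℝ} (hε : 0 < ε) :
    ∀ᶠ k : ℕ in atTop, ((k : ℝ) + 1) * energy Z (p k) 0 (1 / ((k : ℝ) + 1)) < zeta Z h + ε := by
  set r : ℕ → ℝ := fun k => 1 / ((k : ℝ) + 1) with hr
  have hr0 : ∀ k, 0 < r k := fun k => by simp only [hr]; positivity
  have hrk : ∀ k : ℕ, ((k : ℝ) + 1) * r k = 1 := fun k => by simp only [hr]; field_simp
  set d : ℕ → ℝ := fun k => p k (r k) with hd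
  have hd0 : ∀ k, 0 ≤ d k := fun k => by
    have := hp k (left_mem_Icc.2 (hr0 k).le) (right_mem_Icc.2 (hr0 k).le) (hr0 k).le
    rwa [hp0] at this
  have hh : 0 ≤ h := ge_of_tendsto' hlim fun k => mul_nonneg (by positivity) (hd0 k)
  set V : ℕ → ℤ → ℝ := fun k i => i * d k with hV
  set w : ℕ → ℝ → ℝ := fun k => glue (r k) (V k) (fun _ => p k) with hw
  have hVs : ∀ k (i : ℤ), p k (r k) = V k (i + 1) - V k i := fun k i => by
    simp only [hV, hd]; push_cast; ring
  have hwm : ∀ k, Monotone (w k) := fun k =>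
    monotone_glue (hr0 k) (fun _ => hp k) (fun _ => hp0 k) (hVs k)
  have hen : ∀ k, energy Z (w k) 0 1 = ((k : ℝ) + 1) * energy Z (p k) 0 (r k) := fun k => by
    have := hZ.energy_glue (hr0 k) (fun _ => hp k) (fun _ => hp0 k) (hVs k) (k + 1)
    push_cast at this
    rw [hrk] at this
    rw [hw, this]
    simp
  have hdlim : Tendsto d atTop (𝓝 0) := by
    have := hlim.mul (tendsto_one_div_add_atTop_nhds_zero_nat (𝕜 := ℝ))
    rw [mul_zero] at this
    refine this.congr fun k => ?_
    change ((k : ℝ) + 1) * d k * r k = d k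
    rw [mul_right_comm, hrk, one_mul]
  have hnear : ∀ k x, |w k x - ((k : ℝ) + 1) * d k * x| ≤ d k := by
    intro k x
    have h1 : V k ⌊x / r k⌋ ≤ w k x := le_glue (hr0 k) (fun _ => hp k) (fun _ => hp0 k) x
    have h2 : w k x ≤ V k (⌊x / r k⌋ + 1) := glue_le (hr0 k) (fun _ => hp k) (hVs k) x
    have e : x / r k = ((k : ℝ) + 1) * x := by
      rw [div_eq_iff (hr0 k).ne', mul_right_comm, hrk, one_mul]
    have h3 := mul_le_mul_of_nonneg_right (Int.floor_le (x / r k)) (hd0 k)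
    have h4 := mul_le_mul_of_nonneg_right (Int.lt_floor_add_one (x / r k)).le (hd0 k)
    rw [e] at h1 h2 h3 h4
    simp only [hV] at h1 h2
    push_cast at h2
    rw [abs_le]
    constructor <;> linarith
  obtain ⟨B, hB⟩ := hlim.bddAbove_range
  have hB' : ∀ k : ℕ, ((k : ℝ) + 1) * d k ≤ B := fun k => hB (mem_range_self k)
  have := hZ.energy_usc_of_ae (g := fun x => max h 0 * x) (M := 2 * B) zero_le_one
    (fun k => (hwm k).monotoneOn _) ((monotone_mul (le_max_right _ _)).monotoneOn _) ?_ ?_ hε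
  · filter_upwards [this] with k hk
    rwa [hen] at hk
  · intro k x hx
    have h1 := abs_le.1 (hnear k x)
    have h2 : 0 ≤ ((k : ℝ) + 1) * d k := mul_nonneg (by positivity) (hd0 k)
    have h3 : ((k : ℝ) + 1) * d k * x ≤ ((k : ℝ) + 1) * d k := mul_le_of_le_one_right h2 hx.2
    have h4 : 0 ≤ ((k : ℝ) + 1) * d k * x := mul_nonneg h2 hx.1
    have h5 : d k ≤ ((k : ℝ) + 1) * d k := by
      have : 0 ≤ (k : ℝ) * d k := mul_nonneg (by positivity) (hd0 k)
      linarith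
    rw [abs_le]
    constructor <;> linarith [hB' k]
  · refine Eventually.of_forall fun x _ => ?_
    rw [max_eq_left hh]
    have h1 : Tendsto (fun k => w k x - ((k : ℝ) + 1) * d k * x) atTop (𝓝 0) :=
      squeeze_zero_norm (fun k => hnear k x) hdlim
    have h2 := h1.add (hlim.mul_const x)
    rw [zero_add] at h2
    exact h2.congr fun k => sub_add_cancel _ _

lemma IsAdmissible.zeta_nonneg (hZ : IsAdmissible Z) (t : ℝ) : 0 ≤ zeta Z t := by
  refine le_of_forall_pos_lt_add fun ε hε => ?_
  have hz : zeta Z t = zeta Z (max t 0) := by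
    simp [zeta]
  rw [hz]
  -- Arcs that are affine up to a kink at their right end point have energy zero.
  set p : ℕ → ℝ → ℝ := fun k x => if x < 1 / ((k : ℝ) + 1) then 0 else max t 0 / ((k : ℝ) + 1)
    with hp
  have h := hZ.energy_arc_lt (p := p) (h := max t 0) (fun k => ?_) (fun k => ?_) ?_ hε
  · obtain ⟨k, hk⟩ := h.exists
    have e : energy Z (p k) 0 (1 / ((k : ℝ) + 1)) = energy Z (fun _ => 0) 0 (1 / ((k : ℝ) + 1)) :=
      energy_congr fun x hx => if_pos hx.2
    rwa [e, hZ.energy_const _ (by positivity), mul_zero] at hk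
  · have h0 : 0 ≤ max t 0 / ((k : ℝ) + 1) := div_nonneg (le_max_right _ _) (by positivity)
    intro x _ y _ hxy
    simp only [hp]
    split_ifs <;> linarith
  · simp only [hp]
    rw [if_pos (by positivity)]
  · refine tendsto_const_nhds.congr fun k => ?_
    simp only [hp, lt_irrefl, if_false]
    rw [mul_div_cancel₀ _ (by positivity)]

lemma IsAdmissible.concaveOn_zeta (hZ : IsAdmissible Z) : ConcaveOn ℝ (Ici 0) (zeta Z) := by
  refine ⟨convex_Ici 0, fun s hs t ht α β hα hβ hαβ => ?_⟩
  rw [mem_Ici] at hs ht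
  simp only [smul_eq_mul]
  refine le_of_forall_pos_lt_add fun ε hε => ?_
  set r : ℕ → ℝ := fun k => 1 / ((k : ℝ) + 1) with hr
  have hr0 : ∀ k, 0 < r k := fun k => by simp only [hr]; positivity
  have hrk : ∀ k : ℕ, ((k : ℝ) + 1) * r k = 1 := fun k => by simp only [hr]; field_simp
  have hα1 : ∀ k, α * r k ≤ r k := fun k => mul_le_of_le_one_left (hr0 k).le (by linarith)
  have hα0 : ∀ k, 0 ≤ α * r k := fun k => mul_nonneg hα (hr0 k).le
  -- Slope `s` on the first `α`-part of the arc, slope `t` on the rest.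
  set p : ℕ → ℝ → ℝ := fun k x => s * min x (α * r k) + t * max (x - α * r k) 0 with hp
  have hpm : ∀ k, Monotone (p k) := fun k x y hxy => by
    simp only [hp]
    gcongr
  have h := hZ.energy_arc_lt (p := p) (h := α * s + β * t) (fun k => (hpm k).monotoneOn _)
    (fun k => ?_) ?_ hε
  · obtain ⟨k, hk⟩ := h.exists
    refine lt_of_eq_of_lt ?_ hk
    have e1 : energy Z (p k) 0 (α * r k) = energy Z (fun x => s * x) 0 (α * r k) :=
      energy_congr fun x hx => by
        simp only [hp]
        rw [min_eq_left hx.2.le, max_eq_right (by linarith [hx.2])]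
        ring
    have e2 : energy Z (p k) (α * r k) (r k) = energy Z (fun x => t * x) (α * r k) (r k) := by
      rw [← hZ.energy_add_const (s * (α * r k) - t * (α * r k)) (hα1 k)
        ((monotone_mul ht).monotoneOn _)]
      refine energy_congr fun x hx => ?_
      simp only [hp]
      rw [min_eq_right hx.1.le, max_eq_left (by linarith [hx.1])]
      ring
    rw [← hZ.energy_add (hα0 k) (hα1 k) ((hpm k).monotoneOn _), e1, e2,
      hZ.energy_mul hs (hα0 k), hZ.energy_mul ht (hα1 k)]
    have h1 := hrk k
    obtain rfl : β = 1 - α := by linarith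
    linear_combination (-(α * zeta Z s) - (1 - α) * zeta Z t) * h1
  · simp only [hp]
    rw [min_eq_left (hα0 k), max_eq_right (by linarith [hα0 k])]
    ring
  · refine tendsto_const_nhds.congr fun k => ?_
    simp only [hp]
    change _ = ((k : ℝ) + 1) * (s * min (r k) _ + t * max (r k - _) 0)
    rw [min_eq_right (hα1 k), max_eq_left (by linarith [hα1 k])]
    have h1 := hrk k
    obtain rfl : β = 1 - α := by linarith
    linear_combination (-(α * s) - (1 - α) * t) * h1

/-! ### The density belongs to the class of admissible concave functions -/

lemma IsAdmissible.zeta_zero (hZ : IsAdmissible Z) : zeta Z 0 = 0 := by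
  simp only [zeta, max_self, zero_mul]
  exact hZ.energy_const 0 zero_le_one

lemma IsAdmissible.tendsto_zeta_zero (hZ : IsAdmissible Z) : Tendsto (zeta Z) (𝓝 0) (𝓝 0) := by
  refine tendsto_of_seq_tendsto fun t ht => ?_
  obtain ⟨B, hB⟩ := ht.bddAbove_range
  have hB' : ∀ k, t k ≤ B := fun k => hB (mem_range_self k)
  rw [Metric.tendsto_nhds]
  intro ε hε
  have h := hZ.energy_usc_of_ae (φ := fun k x => max (t k) 0 * x) (g := fun _ => 0) (M := max B 0)
    zero_le_one (fun k => (monotone_mul (le_max_right _ _)).monotoneOn _) monotoneOn_const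
    (fun k x hx => ?_) (Eventually.of_forall fun x _ => ?_) hε
  · filter_upwards [h] with k hk
    rw [hZ.energy_const 0 zero_le_one, zero_add] at hk
    rw [Real.dist_eq, sub_zero, Function.comp_apply, abs_of_nonneg (hZ.zeta_nonneg _)]
    exact hk
  · rw [abs_of_nonneg (mul_nonneg (le_max_right _ _) hx.1)]
    exact (mul_le_of_le_one_right (le_max_right _ _) hx.2).trans (max_le_max_right _ (hB' k))
  · have := (ht.max (tendsto_const_nhds (x := (0 : ℝ)))).mul_const x
    simpa using this

lemma IsAdmissible.continuous_zeta (hZ : IsAdmissible Z) : Continuous (zeta Z) := by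
  have h1 : ContinuousOn (zeta Z) (Ici 0) := by
    intro t ht
    rcases (mem_Ici.1 ht).eq_or_lt with rfl | ht
    · have := hZ.tendsto_zeta_zero
      refine ContinuousAt.continuousWithinAt ?_
      rwa [ContinuousAt, hZ.zeta_zero]
    · have := hZ.concaveOn_zeta.continuousOn_interior
      rw [interior_Ici] at this
      exact (this.continuousAt (Ioi_mem_nhds ht)).continuousWithinAt
  have e : zeta Z = fun t => zeta Z (max t 0) := by
    ext t
    simp [zeta]
  rw [e]
  exact h1.comp_continuous (by fun_prop) fun t => mem_Ici.2 (le_max_right _ _)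

/-- The functions with second derivative `t` on `[0, 1 / t]` that are affine elsewhere converge to
a piecewise affine function. -/
lemma IsAdmissible.tendsto_zeta_div (hZ : IsAdmissible Z) :
    Tendsto (fun t => zeta Z t / t) atTop (𝓝 0) := by
  refine tendsto_of_seq_tendsto fun t ht => ?_
  -- The truncation at `1` only affects finitely many terms and keeps `1 / s k` inside `[0, 1]`.
  set s : ℕ → ℝ := fun k => max (t k) 1 with hs
  have hs1 : ∀ k, 1 ≤ s k := fun k => le_max_right _ _
  have hs0 : ∀ k, 0 < s k := fun k => zero_lt_one.trans_le (hs1 k)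
  have hst : ∀ᶠ k in atTop, s k = t k :=
    (ht.eventually_ge_atTop 1).mono fun k hk => max_eq_left hk
  have hslim : Tendsto s atTop atTop := tendsto_atTop_mono (fun k => le_max_left _ _) ht
  set φ : ℕ → ℝ → ℝ := fun k x => min (max (s k * x) 0) 1 with hφ
  have hφm : ∀ k, Monotone (φ k) := fun k x y hxy => by
    have := (hs0 k).le
    simp only [hφ]
    gcongr
  set g : ℝ → ℝ := fun x => if 0 < x then 1 else 0 with hg
  have hgm : Monotone g := fun x y hxy => by
    simp only [hg]
    split_ifs with h1 h2
    · exact le_rfl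
    · exact absurd (h1.trans_le hxy) h2
    · exact zero_le_one
    · exact le_rfl
  have hen : ∀ k, energy Z (φ k) (-1) 1 = zeta Z (s k) / s k := by
    intro k
    have h1 : 1 / s k ≤ 1 := (div_le_one (hs0 k)).2 (hs1 k)
    have h0 : 0 ≤ 1 / s k := by have := hs0 k; positivity
    rw [← hZ.energy_add (b := 0) (by norm_num) zero_le_one ((hφm k).monotoneOn _),
      ← hZ.energy_add h0 h1 ((hφm k).monotoneOn _)]
    have e1 : energy Z (φ k) (-1) 0 = energy Z (fun _ => 0) (-1) 0 := energy_congr fun x hx => by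
      simp only [hφ]
      rw [max_eq_right (mul_nonpos_of_nonneg_of_nonpos (hs0 k).le hx.2.le),
        min_eq_left zero_le_one]
    have e2 : energy Z (φ k) 0 (1 / s k) = energy Z (fun x => s k * x) 0 (1 / s k) :=
      energy_congr fun x hx => by
        simp only [hφ]
        rw [max_eq_left (mul_nonneg (hs0 k).le hx.1.le), min_eq_left]
        have := (lt_div_iff₀ (hs0 k)).1 hx.2
        linarith
    have e3 : energy Z (φ k) (1 / s k) 1 = energy Z (fun _ => 1) (1 / s k) 1 :=
      energy_congr fun x hx => by
        have := (div_lt_iff₀ (hs0 k)).1 hx.1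
        simp only [hφ]
        rw [max_eq_left (by linarith), min_eq_right (by linarith)]
    rw [e1, e2, e3, hZ.energy_const _ (by norm_num), hZ.energy_const _ h1,
      hZ.energy_mul (hs0 k).le h0]
    ring
  have heg : energy Z g (-1) 1 = 0 := by
    rw [← hZ.energy_add (b := 0) (by norm_num) zero_le_one (hgm.monotoneOn _)]
    have e1 : energy Z g (-1) 0 = energy Z (fun _ => 0) (-1) 0 :=
      energy_congr fun x hx => if_neg (not_lt.2 hx.2.le)
    have e2 : energy Z g 0 1 = energy Z (fun _ => 1) 0 1 :=
      energy_congr fun x hx => if_pos hx.1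
    rw [e1, e2, hZ.energy_const _ (by norm_num), hZ.energy_const _ zero_le_one, add_zero]
  rw [Metric.tendsto_nhds]
  intro ε hε
  have h := hZ.energy_usc_of_ae (φ := φ) (g := g) (M := 1) (a := -1) (b := 1) (by norm_num)
    (fun k => (hφm k).monotoneOn _) (hgm.monotoneOn _) (fun k x hx => ?_)
    (Eventually.of_forall fun x _ => ?_) hε
  · filter_upwards [h, hst] with k hk hkt
    rw [hen, heg, zero_add, hkt] at hk
    have : 0 ≤ zeta Z (t k) / t k :=
      div_nonneg (hZ.zeta_nonneg _) (by rw [← hkt]; exact (hs0 k).le)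
    rwa [Real.dist_eq, sub_zero, Function.comp_apply, abs_of_nonneg this]
  · rw [abs_of_nonneg (le_min (le_max_right _ _) zero_le_one)]
    exact min_le_right _ _
  · refine tendsto_const_nhds.congr' ?_
    by_cases hx : 0 < x
    · filter_upwards [(hslim.atTop_mul_const hx).eventually_ge_atTop 1] with k hk
      simp only [hg, hφ, if_pos hx]
      rw [max_eq_left (by linarith), min_eq_right hk]
    · refine Eventually.of_forall fun k => ?_
      simp only [hg, hφ, if_neg hx]
      rw [max_eq_right (mul_nonpos_of_nonneg_of_nonpos (hs0 k).le (not_lt.1 hx)),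
        min_eq_left zero_le_one]

lemma IsAdmissible.isConc_zeta (hZ : IsAdmissible Z) : IsConc (zeta Z) :=
  ⟨fun t _ => hZ.zeta_nonneg t, hZ.concaveOn_zeta,
    hZ.tendsto_zeta_zero.mono_left nhdsWithin_le_nhds, hZ.tendsto_zeta_div⟩

/-! ### The lower bound -/

/-- Difference quotients over shrinking intervals that contain `x` converge to the derivative. -/
lemma tendsto_slope_of_straddle {g' x : ℝ} (h : HasDerivAt g g' x) {l r : ℕ → ℝ}
    (hr : ∀ k, 0 < r k) (hr0 : Tendsto r atTop (𝓝 0)) (h1 : ∀ k, l k ≤ x)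
    (h2 : ∀ k, x ≤ l k + r k) :
    Tendsto (fun k => (g (l k + r k) - g (l k)) / r k) atTop (𝓝 g') := by
  rw [Metric.tendsto_nhds]
  intro ε hε
  have hl : Tendsto l atTop (𝓝 x) := by
    have h3 : Tendsto (fun k => x - r k) atTop (𝓝 x) := by simpa using hr0.const_sub x
    exact tendsto_of_tendsto_of_tendsto_of_le_of_le h3 tendsto_const_nhds
      (fun k => by simp only; linarith [h2 k]) h1
  have hlr : Tendsto (fun k => l k + r k) atTop (𝓝 x) := by simpa using hl.add hr0
  have hb := h.isLittleO.def (half_pos (half_pos hε))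
  filter_upwards [hl.eventually hb, hlr.eventually hb] with k hk1 hk2
  have e1 : |l k - x| ≤ r k := abs_le.2 ⟨by linarith [h2 k], by linarith [h1 k, hr k]⟩
  have e2 : |l k + r k - x| ≤ r k := abs_le.2 ⟨by linarith [h2 k, hr k], by linarith [h1 k]⟩
  rw [Real.norm_eq_abs, Real.norm_eq_abs] at hk1 hk2
  have k1 := abs_le.1 (hk1.trans (mul_le_mul_of_nonneg_left e1 (by positivity)))
  have k2 := abs_le.1 (hk2.trans (mul_le_mul_of_nonneg_left e2 (by positivity)))
  have hlt : |(g (l k + r k) - g (l k)) - g' * r k| < ε * r k := by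
    have := mul_pos hε (hr k)
    rw [abs_lt]
    simp only [smul_eq_mul] at k1 k2
    constructor <;> nlinarith
  have hrk := hr k
  rw [Real.dist_eq, show (g (l k + r k) - g (l k)) / r k - g'
    = ((g (l k + r k) - g (l k)) - g' * r k) / r k by field_simp, abs_div, abs_of_pos hrk,
    div_lt_iff₀ hrk]
  exact hlt

lemma setLIntegral_floor {r : ℝ} (hr : 0 < r) (F : ℤ → ENNReal) (n : ℕ) :
    ∫⁻ x in Ico 0 (n * r), F ⌊x / r⌋ = ∑ i ∈ Finset.range n, F i * ENNReal.ofReal r := by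
  induction n with
  | zero => simp
  | succ n ih =>
    have hu : Ico 0 ((n + 1 : ℕ) * r) = Ico 0 (n * r) ∪ Ico (n * r) ((n + 1 : ℕ) * r) := by
      rw [Ico_union_Ico_eq_Ico (by positivity)]
      push_cast
      nlinarith
    have hc : ∫⁻ x in Ico (n * r) ((n + 1 : ℕ) * r), F ⌊x / r⌋ = F n * ENNReal.ofReal r := by
      rw [setLIntegral_congr_fun (g := fun _ => F n) measurableSet_Ico]
      · rw [setLIntegral_const, Real.volume_Ico]
        congr 2
        push_cast
        ring
      · intro x hx
        have hfl : ⌊x / r⌋ = (n : ℤ) := by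
          rw [Int.floor_eq_iff, le_div_iff₀ hr, div_lt_iff₀ hr]
          have h1 := hx.1
          have h2 := hx.2
          push_cast at h1 h2 ⊢
          exact ⟨h1, h2⟩
        simp only [hfl]
    rw [hu, lintegral_union measurableSet_Ico (Ico_disjoint_Ico_same), ih, hc,
      Finset.sum_range_succ]

/-- Piecewise quadratic interpolation of the slope `g` at equidistant points converges to the given
function; Fatou's lemma then passes to the limit in the energies. -/
lemma IsAdmissible.lintegral_zeta_deriv_le_aux (hZ : IsAdmissible Z) (hg : Monotone g) {L : ℝ}
    (hL : 0 < L) :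
    0 ≤ energy Z g 0 L ∧
      ∫⁻ x in Ico 0 L, ENNReal.ofReal (zeta Z (deriv g x)) ≤ ENNReal.ofReal (energy Z g 0 L) := by
  set r : ℕ → ℝ := fun k => L / ((k : ℝ) + 1) with hr
  have hr0 : ∀ k, 0 < r k := fun k => by simp only [hr]; positivity
  have hrk : ∀ k : ℕ, ((k + 1 : ℕ) : ℝ) * r k = L := fun k => by
    simp only [hr]; push_cast; field_simp
  have hrlim : Tendsto r atTop (𝓝 0) := by
    have := (tendsto_one_div_add_atTop_nhds_zero_nat (𝕜 := ℝ)).const_mul L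
    simpa [hr, div_eq_mul_inv] using this
  have hrL : ∀ k, r k ≤ L := fun k => div_le_self hL.le (by simp)
  set V : ℕ → ℤ → ℝ := fun k i => g (i * r k) with hV
  set t : ℕ → ℤ → ℝ := fun k i => (V k (i + 1) - V k i) / r k with ht
  set q : ℕ → ℤ → ℝ → ℝ := fun k i y => t k i * y with hq
  have ht0 : ∀ k i, 0 ≤ t k i := fun k i => by
    refine div_nonneg (sub_nonneg.2 (hg ?_)) (hr0 k).le
    push_cast
    nlinarith [hr0 k]
  have hqm : ∀ k i, MonotoneOn (q k i) (Icc 0 (r k)) := fun k i =>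
    (monotone_mul (ht0 k i)).monotoneOn _
  have hq0 : ∀ k i, q k i 0 = 0 := fun k i => by simp [hq]
  have hqr : ∀ k i, q k i (r k) = V k (i + 1) - V k i := fun k i => by
    simp only [hq, ht]; exact div_mul_cancel₀ _ (hr0 k).ne'
  set φ : ℕ → ℝ → ℝ := fun k => glue (r k) (V k) (q k) with hφ
  have hφm : ∀ k, Monotone (φ k) := fun k => monotone_glue (hr0 k) (hqm k) (hq0 k) (hqr k)
  have hen : ∀ k, energy Z (φ k) 0 L = ∑ i ∈ Finset.range (k + 1), r k * zeta Z (t k i) := by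
    intro k
    have := hZ.energy_glue (hr0 k) (hqm k) (hq0 k) (hqr k) (k + 1)
    rw [hrk] at this
    rw [hφ, this]
    refine Finset.sum_congr rfl fun i _ => ?_
    rw [hq, hZ.energy_mul (ht0 k i) (hr0 k).le, sub_zero]
  have hint : ∀ k, ∫⁻ x in Ico 0 L, ENNReal.ofReal (zeta Z (t k ⌊x / r k⌋))
      = ENNReal.ofReal (energy Z (φ k) 0 L) := by
    intro k
    have := setLIntegral_floor (hr0 k) (fun i => ENNReal.ofReal (zeta Z (t k i))) (k + 1)
    rw [hrk] at this
    rw [this, hen, ENNReal.ofReal_sum_of_nonneg fun i _ => mul_nonneg (hr0 k).le (hZ.zeta_nonneg _)]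
    refine Finset.sum_congr rfl fun i _ => ?_
    rw [mul_comm, ENNReal.ofReal_mul (hr0 k).le]
  have hcell : ∀ k x, (⌊x / r k⌋ : ℝ) * r k ≤ x ∧ x ≤ ⌊x / r k⌋ * r k + r k := fun k x => by
    have := sub_floor_mul_mem (hr0 k) x
    exact ⟨by linarith [this.1], by linarith [this.2]⟩
  have hlo : ∀ k x, g (⌊x / r k⌋ * r k) ≤ φ k x := fun k x =>
    le_glue (V := V k) (hr0 k) (hqm k) (hq0 k) x
  have hup : ∀ k x, φ k x ≤ g ((⌊x / r k⌋ + 1) * r k) := fun k x => by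
    have := glue_le (hr0 k) (hqm k) (hqr k) x
    simp only [hV] at this
    push_cast at this
    exact this
  have husc : ∀ ε > 0, ∀ᶠ k in atTop, energy Z (φ k) 0 L < energy Z g 0 L + ε := by
    intro ε hε
    refine hZ.energy_usc_of_ae (M := max |g (-L)| |g (2 * L)|) hL.le
      (fun k => (hφm k).monotoneOn _) (hg.monotoneOn _) (fun k x hx => ?_) ?_ hε
    · have h1 := hcell k x
      refine abs_le_max_abs_abs (le_trans (hg ?_) (hlo k x))
        ((hup k x).trans (hg ?_))
      · linarith [hx.1, hrL k]
      · linarith [hx.2, hrL k]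
    · filter_upwards [hg.countable_not_continuousAt.ae_notMem volume] with x hx _
      have hx' : ContinuousAt g x := by simpa using hx
      have c1 : Tendsto (fun k => x - r k) atTop (𝓝 x) := by simpa using hrlim.const_sub x
      have c2 : Tendsto (fun k => x + r k) atTop (𝓝 x) := by simpa using hrlim.const_add x
      refine tendsto_of_tendsto_of_tendsto_of_le_of_le (hx'.tendsto.comp c1) (hx'.tendsto.comp c2)
        (fun k => ?_) (fun k => ?_)
      · refine le_trans (hg ?_) (hlo k x)
        linarith [(hcell k x).2]
      · refine (hup k x).trans (hg ?_)
        linarith [(hcell k x).1]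
  have hen0 : ∀ k, 0 ≤ energy Z (φ k) 0 L := fun k => by
    rw [hen]
    exact Finset.sum_nonneg fun i _ => mul_nonneg (hr0 k).le (hZ.zeta_nonneg _)
  refine ⟨le_of_forall_pos_lt_add fun ε hε => ?_, ?_⟩
  · obtain ⟨k, hk⟩ := (husc ε hε).exists
    exact (hen0 k).trans_lt hk
  have hlim : ∀ᵐ x, Tendsto (fun k => ENNReal.ofReal (zeta Z (t k ⌊x / r k⌋))) atTop
      (𝓝 (ENNReal.ofReal (zeta Z (deriv g x)))) := by
    filter_upwards [hg.ae_differentiableAt] with x hx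
    refine ENNReal.tendsto_ofReal ((hZ.continuous_zeta.tendsto _).comp ?_)
    have := tendsto_slope_of_straddle hx.hasDerivAt hr0 hrlim (fun k => (hcell k x).1)
      (fun k => (hcell k x).2)
    refine this.congr fun k => ?_
    simp only [ht, hV]
    push_cast
    rw [add_mul, one_mul]
  have hfatou : ∫⁻ x in Ico 0 L, liminf (fun k => ENNReal.ofReal (zeta Z (t k ⌊x / r k⌋))) atTop
      ≤ liminf (fun k => ∫⁻ x in Ico 0 L, ENNReal.ofReal (zeta Z (t k ⌊x / r k⌋))) atTop :=
    lintegral_liminf_le fun k =>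
      (Measurable.of_discrete (f := fun i : ℤ => ENNReal.ofReal (zeta Z (t k i)))).comp
        (Int.measurable_floor.comp (measurable_id.div_const _))
  have hle : ∀ ε > 0, ∫⁻ x in Ico 0 L, ENNReal.ofReal (zeta Z (deriv g x))
      ≤ ENNReal.ofReal (energy Z g 0 L + ε) := by
    intro ε hε
    calc ∫⁻ x in Ico 0 L, ENNReal.ofReal (zeta Z (deriv g x))
        = ∫⁻ x in Ico 0 L, liminf (fun k => ENNReal.ofReal (zeta Z (t k ⌊x / r k⌋))) atTop :=
          lintegral_congr_ae ((ae_restrict_of_ae hlim).mono fun x hx => hx.liminf_eq.symm)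
      _ ≤ _ := hfatou
      _ ≤ ENNReal.ofReal (energy Z g 0 L + ε) := by
          refine liminf_le_of_frequently_le' (Eventually.frequently ?_)
          filter_upwards [husc ε hε] with k hk
          rw [hint]
          exact ENNReal.ofReal_le_ofReal hk.le
  have hc : Tendsto (fun ε => ENNReal.ofReal (energy Z g 0 L + ε)) (𝓝[>] 0)
      (𝓝 (ENNReal.ofReal (energy Z g 0 L))) := by
    refine (ENNReal.tendsto_ofReal ?_).mono_left nhdsWithin_le_nhds
    have : Continuous fun ε => energy Z g 0 L + ε := by fun_prop
    simpa using this.tendsto 0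
  exact ge_of_tendsto hc (eventually_mem_nhdsWithin.mono hle)

lemma IsAdmissible.energy_nonneg (hZ : IsAdmissible Z) (hg : Monotone g) (hab : a ≤ b) :
    0 ≤ energy Z g a b := by
  rcases hab.eq_or_lt with rfl | hab
  · rw [hZ.energy_self]
  · have hm : Monotone fun x => g (x + a) := fun x y h => hg (by linarith)
    have h := (hZ.lintegral_zeta_deriv_le_aux hm (sub_pos.2 hab)).1
    rwa [hZ.energy_comp_add _ (sub_nonneg.2 hab.le) (hg.monotoneOn _), zero_add,
      sub_add_cancel] at h

lemma IsAdmissible.lintegral_zeta_deriv_le (hZ : IsAdmissible Z) (hg : Monotone g) (hab : a ≤ b) :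
    ∫⁻ x in Icc a b, ENNReal.ofReal (zeta Z (deriv g x)) ≤ ENNReal.ofReal (energy Z g a b) := by
  rw [← restrict_Ico_eq_restrict_Icc]
  rcases hab.eq_or_lt with rfl | hab
  · simp
  · have hm : Monotone fun x => g (x + a) := fun x y h => hg (by linarith)
    have h := (hZ.lintegral_zeta_deriv_le_aux hm (sub_pos.2 hab)).2
    rw [hZ.energy_comp_add _ (sub_nonneg.2 hab.le) (hg.monotoneOn _), zero_add,
      sub_add_cancel] at h
    refine le_trans (le_of_eq ?_) h
    have hp := (measurePreserving_add_right volume a).setLIntegral_comp_preimage_emb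
      (measurableEmbedding_addRight a) (fun x => ENNReal.ofReal (zeta Z (deriv g x))) (Ico a b)
    rw [← hp]
    simp [deriv_comp_add_const]

lemma IsAdmissible.integrableOn_zeta_deriv (hZ : IsAdmissible Z) (hg : Monotone g) (hab : a ≤ b) :
    IntegrableOn (fun x => zeta Z (deriv g x)) (Icc a b) := by
  refine ⟨(hZ.continuous_zeta.measurable.comp (measurable_deriv g)).aestronglyMeasurable, ?_⟩
  rw [hasFiniteIntegral_iff_ofReal (Eventually.of_forall fun x => hZ.zeta_nonneg _)]
  exact (hZ.lintegral_zeta_deriv_le hg hab).trans_lt ENNReal.ofReal_lt_top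

lemma IsAdmissible.integral_zeta_deriv_le (hZ : IsAdmissible Z) (hg : Monotone g) (hab : a ≤ b) :
    ∫ x in Icc a b, zeta Z (deriv g x) ≤ energy Z g a b := by
  rw [integral_eq_lintegral_of_nonneg_ae (Eventually.of_forall fun x => hZ.zeta_nonneg _)
    (hZ.integrableOn_zeta_deriv hg hab).aestronglyMeasurable]
  exact ENNReal.toReal_le_of_le_ofReal (hZ.energy_nonneg hg hab)
    (hZ.lintegral_zeta_deriv_le hg hab)

/-! ### The upper bound -/

/-- The arcs of a convex function over finitely many disjoint intervals can be concatenated to a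
single convex function, whose domain has the total length of the intervals. -/
lemma IsAdmissible.exists_concat (hZ : IsAdmissible Z) (hg : Monotone g) {ι : Type*} [DecidableEq ι]
    (m : ℝ) (l u : ι → ℝ) (s : Finset ι) :
    (∀ i ∈ s, l i < u i) → (∀ i ∈ s, m ≤ l i) →
    (s : Set ι).PairwiseDisjoint (fun i => Ioc (l i) (u i)) →
    ∀ c, m ≤ c → (∀ i ∈ s, u i ≤ c) → ∃ w : ℝ → ℝ, Monotone w ∧ (∀ x, g m ≤ w x ∧ w x ≤ g c) ∧
      energy Z w 0 (∑ i ∈ s, (u i - l i)) = ∑ i ∈ s, energy Z g (l i) (u i) := by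
  refine Finset.induction_on_max_value l s ?_ ?_
  · intro _ _ _ c hmc _
    exact ⟨fun _ => g m, monotone_const, fun x => ⟨le_rfl, hg hmc⟩, by simp [hZ.energy_self]⟩
  · intro j s hj hmax ih hlu hm hdis c hmc hc
    have hluj := hlu j (Finset.mem_insert_self _ _)
    have hmj := hm j (Finset.mem_insert_self _ _)
    have hcj := hc j (Finset.mem_insert_self _ _)
    have hins : ∀ {i}, i ∈ s → i ∈ insert j s := fun hi => Finset.mem_insert_of_mem hi
    -- The interval with the largest left end point lies to the right of all others.
    have hul : ∀ i ∈ s, u i ≤ l j := by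
      intro i hi
      by_contra! hlt
      have hne : i ≠ j := fun h => hj (h ▸ hi)
      have hd := hdis (Finset.mem_coe.2 (hins hi))
        (Finset.mem_coe.2 (Finset.mem_insert_self j s)) hne
      have hmem : l j < min (u i) (u j) := lt_min hlt hluj
      exact disjoint_left.1 hd (⟨(hmax i hi).trans_lt hmem, min_le_left _ _⟩ : _ ∈ Ioc (l i) (u i))
        ⟨hmem, min_le_right _ _⟩
    obtain ⟨w, hwm, hwb, hwe⟩ := ih (fun i hi => hlu i (hins hi)) (fun i hi => hm i (hins hi))
      (hdis.subset (by simp)) (l j) hmj hul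
    set L := ∑ i ∈ s, (u i - l i) with hL
    have hL0 : 0 ≤ L := Finset.sum_nonneg fun i hi => sub_nonneg.2 (hlu i (hins hi)).le
    have hlc : l j ≤ c := hluj.le.trans hcj
    set v : ℝ → ℝ := fun x => if x < L then w x else g (min c (l j + (x - L))) with hv
    have hvL : ∀ x, L ≤ x → g (l j) ≤ v x := fun x hx => by
      simp only [hv, if_neg (not_lt.2 hx)]
      exact hg (le_min hlc (by linarith))
    have hvm : Monotone v := by
      intro x y hxy
      by_cases hx : x < L
      · by_cases hy : y < L
        · simp only [hv, if_pos hx, if_pos hy]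
          exact hwm hxy
        · refine le_trans ?_ (hvL y (not_lt.1 hy))
          simp only [hv, if_pos hx]
          exact (hwb x).2
      · have hy : ¬ y < L := fun h => hx (hxy.trans_lt h)
        simp only [hv, if_neg hx, if_neg hy]
        exact hg (min_le_min_left _ (by linarith))
    refine ⟨v, hvm, fun x => ⟨?_, ?_⟩, ?_⟩
    · by_cases hx : x < L
      · simp only [hv, if_pos hx]
        exact (hwb x).1
      · exact (hg hmj).trans (hvL x (not_lt.1 hx))
    · by_cases hx : x < L
      · simp only [hv, if_pos hx]
        exact (hwb x).2.trans (hg hlc)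
      · simp only [hv, if_neg hx]
        exact hg (min_le_left _ _)
    · have hd : 0 ≤ u j - l j := by linarith
      rw [Finset.sum_insert hj, Finset.sum_insert hj, ← hL, ← hwe, add_comm (u j - l j),
        ← hZ.energy_add hL0 (le_add_of_nonneg_right hd) (hvm.monotoneOn _), add_comm]
      congr 1
      · have h1 := hZ.energy_comp_add (g := v) (a := 0) (b := u j - l j) L hd (hvm.monotoneOn _)
        have h2 := hZ.energy_comp_add (g := g) (a := 0) (b := u j - l j) (l j) hd
          (hg.monotoneOn _)
        rw [zero_add, add_comm _ L] at h1
        rw [zero_add, sub_add_cancel] at h2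
        rw [← h1, ← h2]
        refine energy_congr fun x hx => ?_
        have hxL : ¬ x + L < L := by linarith [hx.1]
        simp only [hv, if_neg hxL]
        rw [add_sub_cancel_right, min_eq_right (by linarith [hx.2]), add_comm]
      · exact energy_congr fun x hx => if_pos hx.2

lemma IsAdmissible.energy_sub (hZ : IsAdmissible Z) (hg : Monotone g) {x y : ℝ} (hx : a ≤ x)
    (hxy : x ≤ y) : energy Z g a y - energy Z g a x = energy Z g x y := by
  rw [← hZ.energy_add hx hxy (hg.monotoneOn _), add_sub_cancel_left]

/-- Concatenating the arcs over short intervals yields a function on a short interval, whose energy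
is small by upper semicontinuity. So no singular part of the second derivative is seen by `Z`. -/
lemma IsAdmissible.absolutelyContinuousOnInterval_energy (hZ : IsAdmissible Z) (hg : Monotone g)
    (hab : a ≤ b) : AbsolutelyContinuousOnInterval (fun x => energy Z g a x) a b := by
  rw [absolutelyContinuousOnInterval_iff]
  intro ε hε
  obtain ⟨δ, hδ, H⟩ := hZ.exists_forall_energy_lt (max |g a| |g b|) hε
  refine ⟨δ, hδ, fun E hE hlen => ?_⟩
  rw [AbsolutelyContinuousOnInterval.disjWithin, mem_ofPred_eq] at hE
  obtain ⟨hmem, hdis⟩ := hE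
  rw [uIcc_of_le hab] at hmem
  set l : ℕ → ℝ := fun i => min (E.2 i).1 (E.2 i).2 with hl
  set u : ℕ → ℝ := fun i => max (E.2 i).1 (E.2 i).2 with hu
  have hlu : ∀ i, l i ≤ u i := fun i => min_le_max
  have hal : ∀ i ∈ Finset.range E.1, a ≤ l i := fun i hi => le_min (hmem i hi).1.1 (hmem i hi).2.1
  have hub : ∀ i ∈ Finset.range E.1, u i ≤ b := fun i hi => max_le (hmem i hi).1.2 (hmem i hi).2.2
  have hdF : ∀ i ∈ Finset.range E.1, dist (energy Z g a (E.2 i).1) (energy Z g a (E.2 i).2)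
      = energy Z g (l i) (u i) := by
    intro i hi
    obtain ⟨h1, h2⟩ := hmem i hi
    rcases le_total (E.2 i).1 (E.2 i).2 with h | h
    · simp only [hl, hu, min_eq_left h, max_eq_right h]
      rw [dist_comm, Real.dist_eq, hZ.energy_sub hg h1.1 h, abs_of_nonneg (hZ.energy_nonneg hg h)]
    · simp only [hl, hu, min_eq_right h, max_eq_left h]
      rw [Real.dist_eq, hZ.energy_sub hg h2.1 h, abs_of_nonneg (hZ.energy_nonneg hg h)]
  have hdl : ∀ i, dist (E.2 i).1 (E.2 i).2 = u i - l i := fun i => by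
    rw [Real.dist_eq, hu, hl, max_sub_min_eq_abs']
  -- Degenerate intervals have energy zero and may lie inside others, so they are left out.
  set s := {i ∈ Finset.range E.1 | l i < u i} with hs
  have hsub : s ⊆ Finset.range E.1 := Finset.filter_subset _ _
  have hdeg : ∀ i ∈ Finset.range E.1, i ∉ s → u i = l i := fun i hi his =>
    le_antisymm (not_lt.1 fun h => his (Finset.mem_filter.2 ⟨hi, h⟩)) (hlu i)
  obtain ⟨w, hwm, hwb, hwe⟩ := hZ.exists_concat hg a l u s
    (fun i hi => (Finset.mem_filter.1 hi).2) (fun i hi => hal i (hsub hi))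
    (hdis.subset (by exact_mod_cast hsub)) b hab (fun i hi => hub i (hsub hi))
  have e1 : ∑ i ∈ s, (u i - l i) = ∑ i ∈ Finset.range E.1, dist (E.2 i).1 (E.2 i).2 := by
    rw [Finset.sum_congr rfl fun i _ => hdl i]
    exact Finset.sum_subset hsub fun i hi his => by rw [hdeg i hi his, sub_self]
  have e2 : ∑ i ∈ s, energy Z g (l i) (u i)
      = ∑ i ∈ Finset.range E.1, dist (energy Z g a (E.2 i).1) (energy Z g a (E.2 i).2) := by
    rw [Finset.sum_congr rfl hdF]
    exact Finset.sum_subset hsub fun i hi his => by rw [hdeg i hi his, hZ.energy_self]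
  rw [← e2, ← hwe, e1]
  exact H w _ (Finset.sum_nonneg fun i _ => dist_nonneg) hlen (hwm.monotoneOn _) fun x _ =>
    abs_le_max_abs_abs (hwb x).1 (hwb x).2

/-- The local form of the upper bound: the energy grows at most at the rate `ζ(g')`. -/
lemma IsAdmissible.deriv_energy_le (hZ : IsAdmissible Z) (hg : Monotone g) {x : ℝ}
    (hx : x ∈ Ioo a b) (hgx : DifferentiableAt ℝ g x) :
    deriv (fun y => energy Z g a y) x ≤ zeta Z (deriv g x) := by
  by_cases hF : DifferentiableAt ℝ (fun y => energy Z g a y) x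
  swap
  -- Here `deriv` takes the value `0`, and `ζ` is nonnegative.
  · rw [deriv_zero_of_not_differentiableAt hF]
    exact hZ.zeta_nonneg _
  set r : ℕ → ℝ := fun k => 1 / ((k : ℝ) + 1) with hr
  have hr0 : ∀ k, 0 < r k := fun k => by simp only [hr]; positivity
  have hrlim : Tendsto r atTop (𝓝 0) := tendsto_one_div_add_atTop_nhds_zero_nat
  have hdiv : ∀ (k : ℕ) (y : ℝ), y / r k = ((k : ℝ) + 1) * y := fun k y => by
    simp only [hr]
    field_simp
  have hquot : ∀ {f : ℝ → ℝ}, DifferentiableAt ℝ f x →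
      Tendsto (fun k : ℕ => ((k : ℝ) + 1) * (f (x + r k) - f x)) atTop (𝓝 (deriv f x)) := by
    intro f hf
    refine (tendsto_slope_of_straddle (l := fun _ => x) hf.hasDerivAt hr0 hrlim
      (fun _ => le_rfl) (fun k => le_add_of_nonneg_right (hr0 k).le)).congr fun k => hdiv k _
  have hshift : Monotone fun y => g (y + x) := fun y z h => hg (by linarith)
  have hen : ∀ k, energy Z (fun y => g (y + x) + -g x) 0 (r k)
      = energy Z g a (x + r k) - energy Z g a x := by
    intro k
    rw [hZ.energy_add_const _ (hr0 k).le (hshift.monotoneOn _),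
      hZ.energy_comp_add _ (hr0 k).le (hg.monotoneOn _), zero_add, add_comm (r k),
      hZ.energy_sub hg hx.1.le (le_add_of_nonneg_right (hr0 k).le)]
  refine le_of_forall_pos_le_add fun ε hε => le_of_tendsto (hquot hF) ?_
  have h := hZ.energy_arc_lt (p := fun _ y => g (y + x) + -g x) (h := deriv g x)
    (fun k => (hshift.add_const _).monotoneOn _) (fun k => by simp) ?_ hε
  · filter_upwards [h] with k hk
    change _ * energy Z _ 0 (r k) < _ at hk
    rw [hen] at hk
    exact hk.le
  · refine (hquot hgx).congr fun k => ?_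
    rw [add_comm x, ← sub_eq_add_neg]

lemma IsAdmissible.energy_eq_integral (hZ : IsAdmissible Z) (hg : Monotone g) (hab : a ≤ b) :
    energy Z g a b = ∫ x in Icc a b, zeta Z (deriv g x) := by
  refine le_antisymm ?_ (hZ.integral_zeta_deriv_le hg hab)
  have hac := hZ.absolutelyContinuousOnInterval_energy hg hab
  have h := hac.integral_deriv_eq_sub
  rw [hZ.energy_self, sub_zero, intervalIntegral.integral_of_le hab] at h
  rw [← h, integral_Icc_eq_integral_Ioc, integral_Ioc_eq_integral_Ioo, integral_Ioc_eq_integral_Ioo]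
  have hi := (intervalIntegrable_iff_integrableOn_Ioo_of_le hab).1 hac.intervalIntegrable_deriv
  refine integral_mono_ae hi ((hZ.integrableOn_zeta_deriv hg hab).mono_set Ioo_subset_Icc_self) ?_
  filter_upwards [ae_restrict_of_ae hg.ae_differentiableAt, ae_restrict_mem measurableSet_Ioo]
    with x hx hxm
  exact hZ.deriv_energy_le hg hxm hx

/-! ### The structure of the functions in the space -/

lemma IsConv.coe_toReal {u : ℝ → EReal} (hu : IsConv u) {x : ℝ} (hx : x ∈ dom u) :
    ((u x).toReal : EReal) = u x :=
  EReal.coe_toReal (ne_of_lt hx) (hu.ne_bot x)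

lemma IsConv.mem_epi {u : ℝ → EReal} (hu : IsConv u) {x : ℝ} (hx : x ∈ dom u) :
    (x, (u x).toReal) ∈ epi u :=
  (hu.coe_toReal hx).ge

lemma IsConv.convexOn {u : ℝ → EReal} (hu : IsConv u) :
    ConvexOn ℝ (dom u) fun x => (u x).toReal := by
  have key : ∀ {x y : ℝ}, x ∈ dom u → y ∈ dom u → ∀ {s t : ℝ}, 0 ≤ s → 0 ≤ t → s + t = 1 →
      u (s * x + t * y) ≤ ((s * (u x).toReal + t * (u y).toReal : ℝ) : EReal) :=
    fun hx hy s t hs ht hst => hu.convex (hu.mem_epi hx) (hu.mem_epi hy) hs ht hst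
  have hcv : Convex ℝ (dom u) := fun x hx y hy s t hs ht hst =>
    (key hx hy hs ht hst).trans_lt (EReal.coe_lt_top _)
  refine ⟨hcv, fun x hx y hy s t hs ht hst => ?_⟩
  have h := key hx hy hs ht hst
  have hd := hcv hx hy hs ht hst
  simp only [smul_eq_mul] at hd ⊢
  rwa [← hu.coe_toReal hd, EReal.coe_le_coe_iff] at h

/-- A function in the space is Lipschitz up to the end points of its domain: lower semicontinuity
and convexity determine the values there. -/
lemma exists_lipschitzWith_of_mem_LC {u : ℝ → EReal} (hu : u ∈ LC) :
    ∃ a b : ℝ, a ≤ b ∧ dom u = Icc a b ∧ (a < b → ∃ (M : NNReal) (F : ℝ → ℝ), LipschitzWith M F ∧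
      EqOn (fun x => (u x).toReal) F (Icc a b)) := by
  obtain ⟨hc, hk, M, hM⟩ := hu
  have hcv := hc.convexOn
  have hdom : dom u = Icc (sInf (dom u)) (sSup (dom u)) :=
    eq_Icc_of_connected_compact ⟨hc.proper, hcv.1.isPreconnected⟩ hk
  refine ⟨sInf (dom u), sSup (dom u), ?_, hdom, ?_⟩
  · rw [← nonempty_Icc, ← hdom]
    exact hc.proper
  generalize sInf (dom u) = a at *
  generalize sSup (dom u) = b at *
  intro hab
  obtain ⟨F, hF, hFe⟩ := LipschitzOnWith.extend_real hM
  refine ⟨M, F, hF, fun e he => ?_⟩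
  rw [hdom, interior_Icc] at hFe
  set m := (a + b) / 2 with hm
  have hmI : m ∈ dom u := by
    rw [hdom]
    constructor <;> linarith
  have hed : e ∈ dom u := by rwa [hdom]
  -- Points of the open interval that tend to `e`.
  set y : ℝ → ℝ := fun t => (1 - t) * e + t * m with hy
  have hyI : ∀ t ∈ Ioo (0 : ℝ) 1, y t ∈ Ioo a b := by
    intro t ht
    have h1 := mul_nonneg (sub_nonneg.2 ht.2.le) (sub_nonneg.2 he.1)
    have h2 := mul_nonneg (sub_nonneg.2 ht.2.le) (sub_nonneg.2 he.2)
    have h3 := mul_pos ht.1 (sub_pos.2 hab)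
    simp only [hy, hm]
    constructor <;> nlinarith
  have hyt : Tendsto y (𝓝[>] 0) (𝓝 e) := by
    have : Continuous y := by fun_prop
    have := this.tendsto 0
    simp only [hy, sub_zero, one_mul, zero_mul, add_zero] at this
    exact this.mono_left nhdsWithin_le_nhds
  have hFy : Tendsto (fun t => F (y t)) (𝓝[>] 0) (𝓝 (F e)) := (hF.continuous.tendsto e).comp hyt
  have hsmall : ∀ᶠ t : ℝ in 𝓝[>] 0, t ∈ Ioo (0 : ℝ) 1 := Ioo_mem_nhdsGT zero_lt_one
  refine le_antisymm ?_ ?_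
  · have : (e, F e) ∈ epi u := by
      refine hc.lsc.mem_of_tendsto (hyt.prodMk_nhds hFy) (hsmall.mono fun t ht => ?_)
      have hyd : y t ∈ dom u := by
        rw [hdom]
        exact Ioo_subset_Icc_self (hyI t ht)
      rw [← hFe (hyI t ht)]
      exact hc.mem_epi hyd
    change u e ≤ (F e : EReal) at this
    rwa [← hc.coe_toReal hed, EReal.coe_le_coe_iff] at this
  · have h2 : Tendsto (fun t : ℝ => (1 - t) * (u e).toReal + t * (u m).toReal) (𝓝[>] 0)
        (𝓝 (u e).toReal) := by
      have : Continuous fun t : ℝ => (1 - t) * (u e).toReal + t * (u m).toReal := by fun_prop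
      have := this.tendsto 0
      simp only [sub_zero, one_mul, zero_mul, add_zero] at this
      exact this.mono_left nhdsWithin_le_nhds
    refine le_of_tendsto_of_tendsto hFy h2 (hsmall.mono fun t ht => ?_)
    simp only
    rw [← hFe (hyI t ht)]
    exact hcv.2 hed hmI (sub_nonneg.2 ht.2.le) ht.1.le (sub_add_cancel _ _)

/-- A function in the space whose domain is not a single point is the primitive of a monotone
function, up to a constant. -/
lemma exists_slope_of_mem_LC {u : ℝ → EReal} (hu : u ∈ LC) :
    ∃ a b : ℝ, a ≤ b ∧ dom u = Icc a b ∧ (a < b → ∃ (g : ℝ → ℝ) (c : ℝ), Monotone g ∧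
      u = restr (fun x => (∫ t in a..x, g t) + (0 * x + c)) a b) := by
  obtain ⟨a, b, hab, hdom, H⟩ := exists_lipschitzWith_of_mem_LC hu
  refine ⟨a, b, hab, hdom, fun hlt => ?_⟩
  obtain ⟨M, F, hF, hFe⟩ := H hlt
  have hcv : ConvexOn ℝ (Icc a b) F := by
    have := hu.1.convexOn
    rw [hdom] at this
    exact this.congr hFe
  have hder : ∀ x ∈ Ioo a b, HasDerivWithinAt F (derivWithin F (Ioi x) x) (Ioi x) x := fun x hx =>
    hcv.hasDerivWithinAt_rightDeriv_of_mem_interior (by rwa [interior_Icc])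
  have hbd : ∀ x ∈ Ioo a b, |derivWithin F (Ioi x) x| ≤ M := by
    intro x hx
    have h := (hasDerivWithinAt_iff_tendsto_slope' self_notMem_Ioi).1 (hder x hx)
    refine le_of_tendsto h.abs (eventually_mem_nhdsWithin.mono fun y hy => ?_)
    have hxy : 0 < y - x := sub_pos.2 hy
    rw [slope_def_field, abs_div, abs_of_pos hxy, div_le_iff₀ hxy]
    have := hF.dist_le_mul y x
    rwa [Real.dist_eq, Real.dist_eq, abs_of_pos hxy] at this
  have hmono := hcv.monotoneOn_rightDeriv
  rw [interior_Icc] at hmono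
  obtain ⟨g, hg, hge⟩ := hmono.exists_monotone_extension
    ⟨-M, by rintro _ ⟨x, hx, rfl⟩; exact (abs_le.1 (hbd x hx)).1⟩
    ⟨M, by rintro _ ⟨x, hx, rfl⟩; exact (abs_le.1 (hbd x hx)).2⟩
  refine ⟨g, F a, hg, ?_⟩
  ext x
  by_cases hx : x ∈ Icc a b
  · have hxd : x ∈ dom u := by rwa [hdom]
    have := intervalIntegral.integral_eq_sub_of_hasDeriv_right_of_le hx.1 hF.continuous.continuousOn
      (fun y hy => by
        have hy' : y ∈ Ioo a b := ⟨hy.1, hy.2.trans_le hx.2⟩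
        rw [← hge hy']
        exact hder y hy') (hg.intervalIntegrable (μ := volume))
    rw [restr_of_mem hx, this, ← hu.1.coe_toReal hxd, EReal.coe_eq_coe_iff]
    have h2 : (u x).toReal = F x := hFe hx
    rw [h2]
    ring
  · rw [restr_of_notMem hx]
    have hxd : x ∉ dom u := by rwa [hdom]
    exact not_lt_top_iff.1 hxd

/-! ### The second derivative -/

lemma HasSecondDerivAt.unique {u : ℝ → EReal} {h₁ h₂ x : ℝ} (H₁ : HasSecondDerivAt u h₁ x)
    (H₂ : HasSecondDerivAt u h₂ x) : h₁ = h₂ := by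
  obtain ⟨-, p₁, H₁⟩ := H₁
  obtain ⟨-, p₂, H₂⟩ := H₂
  have H := H₁.sub H₂
  refine eq_of_forall_dist_le fun ε hε => ?_
  have hb := H.def (half_pos hε)
  -- Adding the expansions at `x + s` and `x - s` eliminates the linear terms.
  have t1 : Tendsto (fun s : ℝ => x + s) (𝓝[>] 0) (𝓝 x) := by
    have : Continuous fun s : ℝ => x + s := by fun_prop
    have := this.tendsto 0
    rw [add_zero] at this
    exact this.mono_left nhdsWithin_le_nhds
  have t2 : Tendsto (fun s : ℝ => x - s) (𝓝[>] 0) (𝓝 x) := by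
    have : Continuous fun s : ℝ => x - s := by fun_prop
    have := this.tendsto 0
    rw [sub_zero] at this
    exact this.mono_left nhdsWithin_le_nhds
  obtain ⟨s, ⟨h1, h2⟩, hs⟩ :=
    (((t1.eventually hb).and (t2.eventually hb)).and eventually_mem_nhdsWithin).exists
  rw [mem_Ioi] at hs
  have hs2 : 0 < s ^ 2 := by positivity
  simp only [Real.norm_eq_abs, add_sub_cancel_left, sub_sub_cancel_left, even_two.neg_pow] at h1 h2
  rw [abs_of_pos hs2] at h1 h2
  have k1 := abs_le.1 h1
  have k2 := abs_le.1 h2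
  rw [Real.dist_eq, abs_le]
  constructor
  · refine le_of_mul_le_mul_right ?_ hs2
    linarith
  · refine le_of_mul_le_mul_right ?_ hs2
    linarith

lemma secondDeriv_eq {u : ℝ → EReal} {h x : ℝ} (H : HasSecondDerivAt u h x) :
    secondDeriv u x = h := by
  have hex : ∃ h, HasSecondDerivAt u h x := ⟨h, H⟩
  rw [secondDeriv, dif_pos hex]
  exact hex.choose_spec.unique H

/-- A primitive of `g` is twice differentiable in the sense of Aleksandrov where `g` is
differentiable. -/
lemma hasSecondDerivAt_restr (hg : Monotone g) {x h : ℝ} (hx : x ∈ Ioo a b)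
    (hgx : HasDerivAt g h x) (k : ℝ) :
    HasSecondDerivAt (restr (fun x => (∫ t in a..x, g t) + (0 * x + k)) a b) h x := by
  refine ⟨by rwa [dom_restr, interior_Icc], g x, ?_⟩
  refine Asymptotics.IsLittleO.of_bound fun ε hε => ?_
  obtain ⟨δ, hδ, hb⟩ := Metric.eventually_nhds_iff.1 (hgx.isLittleO.def hε)
  filter_upwards [Ioo_mem_nhds hx.1 hx.2, Metric.ball_mem_nhds x hδ] with y hy hyδ
  have hi := fun u v => hg.intervalIntegrable (μ := volume) (a := u) (b := v)
  have hi2 : IntervalIntegrable (fun t => g x + (t - x) * h) volume x y :=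
    Continuous.intervalIntegrable (by fun_prop) _ _
  rw [restr_of_mem (Ioo_subset_Icc_self hx), restr_of_mem (Ioo_subset_Icc_self hy),
    EReal.toReal_coe, EReal.toReal_coe]
  have e0 : ∫ t in x..y, (g x + (t - x) * h) = g x * (y - x) + h / 2 * (y - x) ^ 2 := by
    rw [intervalIntegral.integral_add (by simp) (Continuous.intervalIntegrable (by fun_prop) _ _),
      intervalIntegral.integral_mul_const,
      intervalIntegral.integral_sub (by simp) (by simp), integral_id]
    simp only [intervalIntegral.integral_const, smul_eq_mul]
    ring
  have e : (∫ t in a..y, g t) + (0 * y + k) - ((∫ t in a..x, g t) + (0 * x + k)) - g x * (y - x)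
      - h / 2 * (y - x) ^ 2 = ∫ t in x..y, (g t - (g x + (t - x) * h)) := by
    rw [intervalIntegral.integral_sub (hi _ _) hi2, e0,
      ← intervalIntegral.integral_interval_sub_left (hi a y) (hi a x)]
    ring
  rw [e]
  have hbound : ∀ t ∈ uIoc x y, ‖g t - (g x + (t - x) * h)‖ ≤ ε * |y - x| := by
    intro t ht
    have htx : |t - x| ≤ |y - x| := abs_sub_left_of_mem_uIcc (uIoc_subset_uIcc ht)
    have htδ : dist t x < δ := lt_of_le_of_lt htx hyδ
    have := hb htδ
    simp only [smul_eq_mul, Real.norm_eq_abs] at this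
    rw [Real.norm_eq_abs, ← sub_sub]
    exact this.trans (mul_le_mul_of_nonneg_left htx hε.le)
  refine (intervalIntegral.norm_integral_le_of_norm_le_const hbound).trans (le_of_eq ?_)
  rw [norm_pow, Real.norm_eq_abs]
  ring

/-! ### The integral representation -/

lemma IsAdmissible.extZ_restr_integral (hZ : IsAdmissible Z) (hab : a ≤ b)
    (hg : Monotone g) (k : ℝ) :
    extZ Z (restr (fun x => (∫ t in a..x, g t) + (0 * x + k)) a b) = energy Z g a b :=
  hZ.extZ_restr_add_affine (M := ⟨max |g a| |g b|, by positivity⟩) hab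
    (convexOn_integral (hg.monotoneOn _)) (lipschitzOnWith_integral (hg.monotoneOn _)
      fun _ hx => abs_le_of_monotoneOn (hg.monotoneOn _) hx) 0 k

lemma IsAdmissible.integral_representation (hZ : IsAdmissible Z) (u : LC) :
    IntegrableOn (fun x => zeta Z (secondDeriv u.1 x)) (dom u.1) ∧
      Z u = ∫ x in dom u.1, zeta Z (secondDeriv u.1 x) := by
  obtain ⟨a, b, hab, hdom, H⟩ := exists_slope_of_mem_LC u.2
  rcases hab.eq_or_lt with rfl | hlt
  · have h0 : Z u = 0 := hZ.simple u (by simp [hdom])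
    rw [hdom, h0]
    simp
  · obtain ⟨g, k, hg, hu⟩ := H hlt
    have hae : ∀ᵐ x ∂volume.restrict (Icc a b),
        zeta Z (deriv g x) = zeta Z (secondDeriv u.1 x) := by
      rw [← restrict_Ioo_eq_restrict_Icc]
      filter_upwards [ae_restrict_of_ae hg.ae_differentiableAt, ae_restrict_mem measurableSet_Ioo]
        with x hx hxm
      rw [hu, secondDeriv_eq (hasSecondDerivAt_restr hg hxm hx.hasDerivAt k)]
    rw [hdom]
    refine ⟨(hZ.integrableOn_zeta_deriv hg hab).congr hae, ?_⟩
    rw [← integral_congr_ae hae, ← hZ.energy_eq_integral hg hab, ← hZ.extZ_restr_integral hab hg k,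
      ← hu, extZ_coe]

lemma IsAdmissible.zeta_eq (hZ : IsAdmissible Z) {t m : ℝ} (ht : 0 ≤ t) (hm : 0 < m) :
    zeta Z t = Z ⟨quadInd t (-m) m, quadInd_mem_LC ht (neg_le_self hm.le)⟩ / (2 * m) := by
  have hle := neg_le_self hm.le
  have e : quadInd t (-m) m
      = restr (fun x => (∫ s in (-m)..x, t * s) + (0 * x + t * m ^ 2 / 2)) (-m) m := by
    refine restr_congr (f₁ := fun x => t * (x ^ 2 / 2)) fun x _ => ?_
    change t * (x ^ 2 / 2) = (∫ s in (-m)..x, t * s) + (0 * x + t * m ^ 2 / 2)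
    rw [intervalIntegral.integral_const_mul, integral_id]
    ring
  have hq : Z ⟨quadInd t (-m) m, quadInd_mem_LC ht hle⟩ = extZ Z (quadInd t (-m) m) :=
    (extZ_of_mem _).symm
  rw [hq, e, hZ.extZ_restr_integral hle (monotone_mul ht), hZ.energy_mul ht hle]
  field_simp
  ring

end LipConv

end

open LipConv
theorem proposition3p12 (Z : LC → ℝ) (hval : IsValuation Z) (hsimple : IsSimple Z)
    (husc : TauUSC Z) (htrans : TranslationInvariant Z)
    (hdual : DuallyEpiTranslationInvariant Z) (hvanish : VanishesOnIntervals Z) :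
    ∃ ζ : ℝ → ℝ, IsConc ζ ∧
      (∀ u : LC, IntegrableOn (fun x => ζ (secondDeriv u.1 x)) (dom u.1) volume ∧
        Z u = ∫ x in dom u.1, ζ (secondDeriv u.1 x)) ∧
      ∀ (a m : ℝ) (ha : 0 ≤ a) (hm : 0 < m),
        ζ a = Z ⟨quadInd a (-m) m, quadInd_mem_LC ha (neg_le_self hm.le)⟩ / (2 * m) := by
  have hZ : IsAdmissible Z := ⟨hval, hsimple, husc, htrans, hdual, hvanish⟩
  exact ⟨zeta Z, hZ.isConc_zeta, hZ.integral_representation, fun _ _ ha hm => hZ.zeta_eq ha hm⟩
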